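/- Let $f$ be a field of prime characteristic $p$. Let $W_1$ be the Lie algebra of $f$-derivations of $f[t]/(t^p)$ and $l_i=t^{i+1}\frac{d}{dt}$. For $0\le n\le p-1$ let $L_n=\{a\frac{d}{dt}\in W_1 : t^{n+1}\mid a\}$ (spanned by the $l_i$ with $n\le i\le p-2$), and for $0\le m\le n\le p-1$ put $L_{mn}=L_m/L_n$. Let $G_0$ be the group of automorphisms of $f[t]/(t^p)$ over $f$, let $G_n$ for $1\le n\le p-1$ be the subgroup of the $g$ with $g(t)=t+o(t^n)$, i.e. $t^{n+1}\mid g(t)-t$, and put $G_{mn}=G_m/G_n$. The group $G_m$ acts on $L_m$, and $G_{mn}$ on $L_{mn}$, by $D\mapsto gDg^{-1}$; the dual representations on $L_m^*$ and $L_{mn}^*$ are called coadjoint. The projections $L_m\to L_{mi}\to L_{mn}$ ($n\le i$) induce inclusions $L_{mn}^*\subset L_{mi}^*\subset L_m^*$. For $p\ne 2$ let the polynomials $P_{mk}$ over $f$ be defined by $$\sum_{k=1}^{\infty}P_{mk}(x_0,\dots,x_{m+k})z^k=\frac{\sqrt{\sum_{k=0}^{\infty}x_kx_0^{k-1}z^k}-\sqrt{\sum_{k=0}^{m}x_kx_0^{k-1}z^k}}{x_0^mz^m},$$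 the roots being the ones with constant term $1$. For $0\le m\le n\le p-2$, an orbit of the coadjoint representation of $G_{m+1,n+1}$ in $L_{m+1,n+1}^*$ is said to be in a general position if $n\le 2m+2$, or if $n>2m+2$ and $l_n\neq 0$ on it. Let $0\le m\le n\le p-2$. (a) If $n\le 2m+2$, all the orbits of the coadjoint representation of $G_{m+1,n+1}$ in $L_{m+1,n+1}^*$ are points, and every point is an orbit; all orbits are in a general position. (b) If $n>2m+2$ is odd, the orbits in a general position are parametrized bijectively by $c_0\in f^*$, $c_1,\dots,c_m\in f$: they are the affine planes of dimension $n-2m-1$ defined by the equations $l_n=c_0,\ l_{n-1}=c_1,\dots,l_{n-m}=c_m$. (c) If $n>2m+2$ is even, the orbits in a general position are parametrized bijectively by $c_0\in f^*$, $c_1,\dots,c_{m+1}\in f$: they are the sets of $f$-points of the affine varieties of dimension $n-2m-2$ defined by the equations $l_n=c_0,\ l_{n-1}=c_1,\dots,l_{n-m}=c_m,\ P_{mk}(l_n,l_{n-1},\dots,l_{n/2})=c_{m+1}$ with $k=n/2-m$ (these equations generate a prime ideal of $f[l_{m+1},\dots,l_n]$ whose quotient ring has Krull dimension $n-2m-2$).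 (d) Each orbit in a general position of the coadjoint representation of $G_{m+1,n+1}$ in $L_{m+1,n+1}^*$ is an orbit of the coadjoint representation of $G_{m+1,i+1}$ in $L_{m+1,i+1}^*$ for all $i$ with $n\le i\le p-2$, as well as of $G_{m+1}$ in $L_{m+1}^*$. (e) For $m\le i\le p-2$, each orbit of the coadjoint representation of $G_{m+1,i+1}$ in $L_{m+1,i+1}^*$ is an orbit in a general position of the coadjoint representation of $G_{m+1,n+1}$ in $L_{m+1,n+1}^*$ for some $n$ with $\min(2m+2,i)\le n\le i$. (f) Each orbit of the coadjoint representation of $G_{m+1}$ in $L_{m+1}^*$ is an orbit in a general position of the coadjoint representation of $G_{m+1,n+1}$ in $L_{m+1,n+1}^*$ for some $n$ with $\min(2m+2,p-2)\le n\le p-2$. -/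

import Mathlib

noncomputable section

namespace TruncatedLine

section Polynomials

variable {R : Type*} [CommRing R]

/-- The coefficients `s 0 = 1, s 1, s 2, …` of the square root, with constant term `1`, of a power
series `1 + a 1 z + a 2 z ^ 2 + …`; here `h` stands for the element `1 / 2` of the ring. -/
def sqrtCoeff (h : R) (a : ℕ → R) : ℕ → R
  | 0 => 1
  | n + 1 => h * (a (n + 1) - ∑ i : Fin n, sqrtCoeff h a (i + 1) * sqrtCoeff h a (n - i))

/-- The square root with constant term `1` of a power series with constant term `1`. -/
def sqrtSeries (h : R) (S : PowerSeries R) : PowerSeries R :=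
  PowerSeries.mk (sqrtCoeff h fun n => PowerSeries.coeff n S)

theorem constantCoeff_sqrtSeries (h : R) (S : PowerSeries R) :
    PowerSeries.constantCoeff (sqrtSeries h S) = 1 := by
  rw [← PowerSeries.coeff_zero_eq_constantCoeff_apply, sqrtSeries, PowerSeries.coeff_mk, sqrtCoeff]

theorem sqrtSeries_sq (h : R) (hh : h * 2 = 1) (S : PowerSeries R)
    (hS : PowerSeries.constantCoeff S = 1) : sqrtSeries h S ^ 2 = S := by
  ext n
  rw [pow_two, PowerSeries.coeff_mul, Finset.Nat.sum_antidiagonal_eq_sum_range_succ_mk]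
  rcases n with _ | n
  · simp [sqrtSeries, sqrtCoeff, hS]
  · rw [Finset.sum_range_succ', Finset.sum_range_succ]
    have e : ∑ x ∈ Finset.range n, (PowerSeries.coeff (x + 1)) (sqrtSeries h S) *
        (PowerSeries.coeff (n + 1 - (x + 1))) (sqrtSeries h S) =
        ∑ i : Fin n, sqrtCoeff h (fun n => PowerSeries.coeff n S) (i + 1) *
          sqrtCoeff h (fun n => PowerSeries.coeff n S) (n - i) := by
      rw [Finset.sum_range]
      refine Finset.sum_congr rfl fun i _ => ?_
      simp [sqrtSeries]
    have e1 : PowerSeries.coeff (n + 1) (sqrtSeries h S) = h * (PowerSeries.coeff (n + 1) S -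
        ∑ i : Fin n, sqrtCoeff h (fun n => PowerSeries.coeff n S) (i + 1) *
          sqrtCoeff h (fun n => PowerSeries.coeff n S) (n - i)) := by
      rw [sqrtSeries, PowerSeries.coeff_mk, sqrtCoeff]
    have e0 : PowerSeries.coeff 0 (sqrtSeries h S) = 1 := by
      simp [constantCoeff_sqrtSeries]
    simp only [e, e0, Nat.sub_self, Nat.sub_zero, one_mul, mul_one, e1]
    linear_combination (PowerSeries.coeff (n + 1) S -
        ∑ i : Fin n, sqrtCoeff h (fun n => PowerSeries.coeff n S) (i + 1) *
          sqrtCoeff h (fun n => PowerSeries.coeff n S) (n - i)) * hh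

variable (f : Type*) [Field f]

/-- The series `∑ x_k x_0 ^ (k - 1) z ^ k`, the sum over all `k ≥ 0`; its term with `k = 0` is
`x_0 x_0 ^ (-1) = 1`. -/
def fullSeries : PowerSeries (MvPolynomial ℕ f) :=
  PowerSeries.mk fun k => if k = 0 then 1 else MvPolynomial.X k * MvPolynomial.X 0 ^ (k - 1)

/-- The series `∑ x_k x_0 ^ (k - 1) z ^ k`, the sum over `0 ≤ k ≤ m`. -/
def cutSeries (m : ℕ) : PowerSeries (MvPolynomial ℕ f) :=
  PowerSeries.mk fun k => if k = 0 then 1 else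
    if k ≤ m then MvPolynomial.X k * MvPolynomial.X 0 ^ (k - 1) else 0

/-- The difference of the square roots of `fullSeries` and `cutSeries m`. -/
def rootDiff (m : ℕ) : PowerSeries (MvPolynomial ℕ f) :=
  sqrtSeries (MvPolynomial.C (2⁻¹ : f)) (fullSeries f) -
    sqrtSeries (MvPolynomial.C (2⁻¹ : f)) (cutSeries f m)

/-- The polynomial `P_{mk}` in the variables `x_0, x_1, …`: the coefficient of `z ^ k` in
`(√(∑_{k ≥ 0} x_k x_0 ^ (k - 1) z ^ k) - √(∑_{k ≤ m} x_k x_0 ^ (k - 1) z ^ k)) / (x_0 ^ m z ^ m)`.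
The division is exact when `2 ≠ 0` in `f`, see `generatingFunction`. -/
def P (m k : ℕ) : MvPolynomial ℕ f :=
  (PowerSeries.coeff (m + k) (rootDiff f m)).divMonomial (Finsupp.single 0 m)

/-- If `2 ≠ 0` in `f`, then `∑_{k ≥ 0} P_{mk} z ^ k`, with `P_{m0} = 0`, is the generating function
above, multiplied out. -/
theorem generatingFunction (h2 : (2 : f) ≠ 0) (m : ℕ) :
    PowerSeries.C (MvPolynomial.X 0 ^ m) * PowerSeries.X ^ m * PowerSeries.mk (P f m) =
      rootDiff f m ∧ P f m 0 = 0 := by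
  have hh : (MvPolynomial.C (2⁻¹ : f) : MvPolynomial ℕ f) * 2 = 1 := by
    rw [← map_ofNat (MvPolynomial.C : f →+* MvPolynomial ℕ f) 2, ← MvPolynomial.C_mul,
      inv_mul_cancel₀ h2, MvPolynomial.C_1]
  obtain ⟨T, hT⟩ : ∃ T : PowerSeries (MvPolynomial ℕ f),
      fullSeries f - cutSeries f m =
        PowerSeries.C (MvPolynomial.X 0 ^ m) * PowerSeries.X ^ (m + 1) * T := by
    refine ⟨PowerSeries.mk fun k => MvPolynomial.X (k + m + 1) * MvPolynomial.X 0 ^ k, ?_⟩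
    ext1 n
    rw [mul_assoc, PowerSeries.coeff_C_mul, PowerSeries.coeff_X_pow_mul']
    rcases n with _ | n
    · simp [fullSeries, cutSeries]
    · simp only [fullSeries, cutSeries, map_sub, PowerSeries.coeff_mk]
      by_cases h : n + 1 ≤ m
      · have : ¬ m + 1 ≤ n + 1 := by omega
        simp [h, this]
      · have h' : m + 1 ≤ n + 1 := by omega
        obtain ⟨d, rfl⟩ := Nat.exists_eq_add_of_le (Nat.le_of_succ_le_succ h')
        have e1 : m + d + 1 - (m + 1) = d := by omega
        simp only [h, h', if_true, if_false, e1, Nat.add_sub_cancel, Nat.succ_ne_zero, sub_zero,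
          pow_add, Nat.add_comm d m]
        ring
  set s := sqrtSeries (MvPolynomial.C (2⁻¹ : f)) (fullSeries f) with hs
  set c := sqrtSeries (MvPolynomial.C (2⁻¹ : f)) (cutSeries f m) with hc
  have hs2 : s ^ 2 = fullSeries f := sqrtSeries_sq _ hh _ (by
    rw [← PowerSeries.coeff_zero_eq_constantCoeff_apply]; simp [fullSeries])
  have hc2 : c ^ 2 = cutSeries f m := sqrtSeries_sq _ hh _ (by
    rw [← PowerSeries.coeff_zero_eq_constantCoeff_apply]; simp [cutSeries])
  have hu : IsUnit (s + c) := by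
    rw [PowerSeries.isUnit_iff_constantCoeff, map_add, hs, hc, constantCoeff_sqrtSeries,
      constantCoeff_sqrtSeries, one_add_one_eq_two]
    exact IsUnit.of_mul_eq_one_right _ hh
  obtain ⟨v, hv⟩ := hu.exists_right_inv
  have hD : rootDiff f m = PowerSeries.C (MvPolynomial.X 0 ^ m) * PowerSeries.X ^ m *
      (PowerSeries.X * (T * v)) := by
    have h1 : rootDiff f m = s - c := rfl
    calc rootDiff f m = (s ^ 2 - c ^ 2) * v := by
          rw [h1]; linear_combination (c - s) * hv
      _ = _ := by rw [hs2, hc2, hT]; ring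
  have hP : PowerSeries.mk (P f m) = PowerSeries.X * (T * v) := by
    ext1 k
    rw [PowerSeries.coeff_mk, P, hD, mul_assoc, PowerSeries.coeff_C_mul, Nat.add_comm m k,
      PowerSeries.coeff_X_pow_mul, MvPolynomial.X_pow_eq_monomial,
      MvPolynomial.divMonomial_monomial_mul]
  refine ⟨by rw [hP, hD], ?_⟩
  have := congrArg (PowerSeries.coeff 0) hP
  simpa using this

end Polynomials

section Groups

variable (f : Type*) [Field f] (p : ℕ)

/-- The truncated polynomial algebra `f[t] / (t ^ p)`. -/
abbrev Trunc : Type _ := AdjoinRoot (Polynomial.X ^ p : Polynomial f)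

/-- The class of `t` in `f[t] / (t ^ p)`. -/
def t : Trunc f p := AdjoinRoot.root _

/-- The Lie algebra `W_1` of `f`-derivations of `f[t] / (t ^ p)`. -/
abbrev W : Type _ := Derivation f (Trunc f p) (Trunc f p)

/-- The group of automorphisms of `f[t] / (t ^ p)` that fix the constants. -/
abbrev Aut : Type _ := Trunc f p ≃ₐ[f] Trunc f p

variable {f p}

theorem t_pow : t f p ^ p = 0 := by
  have := AdjoinRoot.mk_self (f := (Polynomial.X ^ p : Polynomial f))
  rwa [map_pow] at this

theorem mk_eq_aeval (q : Polynomial f) :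
    AdjoinRoot.mk (Polynomial.X ^ p) q = Polynomial.aeval (t f p) q :=
  (AdjoinRoot.aeval_eq q).symm

theorem exists_aeval (a : Trunc f p) : ∃ q : Polynomial f, a = Polynomial.aeval (t f p) q := by
  obtain ⟨q, rfl⟩ := AdjoinRoot.mk_surjective a
  exact ⟨q, mk_eq_aeval q⟩

theorem exists_const_add (a : Trunc f p) :
    ∃ (c : f) (b : Trunc f p), a = algebraMap f _ c + t f p * b := by
  obtain ⟨q, rfl⟩ := exists_aeval a
  refine ⟨q.coeff 0, Polynomial.aeval (t f p) q.divX, ?_⟩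
  conv_lhs => rw [← Polynomial.X_mul_divX_add q]
  rw [map_add, map_mul, Polynomial.aeval_X, Polynomial.aeval_C, add_comm]

theorem dvd_apply_t (g : Aut f p) : t f p ∣ g (t f p) := by
  obtain ⟨c, b, h⟩ := exists_const_add (g (t f p))
  by_cases hc : c = 0
  · exact ⟨b, by rw [h, hc]; simp⟩
  · have hn : IsNilpotent (t f p * b) := ⟨p, by rw [mul_pow, t_pow, zero_mul]⟩
    have hu : IsUnit (g (t f p)) := by
      rw [h]
      exact hn.isUnit_add_left_of_commute
        ((isUnit_iff_ne_zero.mpr hc).map (algebraMap f (Trunc f p))) (Commute.all _ _)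
    have h0 : IsUnit ((g (t f p)) ^ p) := hu.pow p
    rw [← map_pow, t_pow, map_zero] at h0
    have := isUnit_zero_iff.mp h0
    exact ⟨0, by rw [← mul_one (g (t f p)), ← this]; simp⟩

theorem pow_dvd_map (g : Aut f p) {n : ℕ} {a : Trunc f p} (h : t f p ^ n ∣ a) :
    t f p ^ n ∣ g a := by
  have := map_dvd g h
  rw [map_pow] at this
  exact (pow_dvd_pow_of_dvd (dvd_apply_t g) n).trans this

theorem pow_dvd_sub (g : Aut f p) {n : ℕ} (h : t f p ^ n ∣ g (t f p) - t f p) (a : Trunc f p) :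
    t f p ^ n ∣ g a - a := by
  obtain ⟨q, rfl⟩ := exists_aeval a
  have : g (Polynomial.aeval (t f p) q) = Polynomial.aeval (g (t f p)) q :=
    (Polynomial.aeval_algHom_apply g (t f p) q).symm
  rw [this]
  refine h.trans ?_
  rw [Polynomial.aeval_def, Polynomial.aeval_def, ← Polynomial.eval_map, ← Polynomial.eval_map]
  exact Polynomial.sub_dvd_eval_sub _ _ _

theorem apply_t_dvd (D : W f p) (a : Trunc f p) : D (t f p) ∣ D a := by
  obtain ⟨q, rfl⟩ := exists_aeval a
  rw [Derivation.map_aeval]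
  exact ⟨_, by rw [smul_eq_mul, mul_comm]⟩

theorem pow_dvd_of_pow_dvd (D : W f p) {m n : ℕ} (h : t f p ^ (m + 1) ∣ D (t f p))
    {a : Trunc f p} (ha : t f p ^ n ∣ a) : t f p ^ n ∣ D a := by
  obtain ⟨b, rfl⟩ := ha
  rw [Derivation.leibniz, Derivation.leibniz_pow, smul_eq_mul, smul_eq_mul]
  refine dvd_add (dvd_mul_right _ _) (Dvd.dvd.mul_left ?_ _)
  rcases n with _ | n
  · simp
  · rw [nsmul_eq_mul, smul_eq_mul, Nat.add_sub_cancel]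
    refine Dvd.dvd.mul_left ?_ _
    rw [pow_succ]
    exact mul_dvd_mul_left _ ((dvd_pow_self _ (Nat.succ_ne_zero m)).trans h)

variable (f p)

/-- The group `G_n` of the automorphisms `g` with `g(t) = t + o(t ^ n)`; `G_0` is the whole group
of automorphisms, see `G_zero`. -/
def G (n : ℕ) : Subgroup (Aut f p) where
  carrier := {g | t f p ^ (n + 1) ∣ g (t f p) - t f p}
  one_mem' := by simp
  mul_mem' {g h} hg hh := by
    have h1 := pow_dvd_sub g hg (h (t f p))
    have := dvd_add h1 hh
    simpa using this
  inv_mem' {g} hg := by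
    have h1 := pow_dvd_sub g hg (g⁻¹ (t f p))
    have h2 : g (g⁻¹ (t f p)) = t f p := g.apply_symm_apply _
    rw [h2] at h1
    exact (dvd_sub_comm).mp h1

theorem G_zero : G f p 0 = ⊤ := by
  refine eq_top_iff.mpr fun g _ => ?_
  change t f p ^ (0 + 1) ∣ g (t f p) - t f p
  simpa using dvd_sub (dvd_apply_t g) (dvd_refl _)

instance G_normal (n : ℕ) : (G f p n).Normal where
  conj_mem g hg h := by
    have h1 := pow_dvd_map h (pow_dvd_sub g hg (h⁻¹ (t f p)))
    have h2 : h (h⁻¹ (t f p)) = t f p := h.apply_symm_apply _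
    rw [map_sub, h2] at h1
    exact h1

/-- The group `G_{mn} = G_m / G_n`, for `m ≤ n`. -/
abbrev Gq (m n : ℕ) : Type _ := G f p m ⧸ (G f p n).subgroupOf (G f p m)

/-- The Lie subalgebra `L_n` of `W_1`, for `n ≥ 0`: the derivations `a(t) d/dt` for which `a(t)` is
divisible by `t ^ (n + 1)`. -/
def L (n : ℕ) : LieSubalgebra f (W f p) where
  carrier := {D | t f p ^ (n + 1) ∣ D (t f p)}
  zero_mem' := by simp
  add_mem' {D E} hD hE := by simpa using dvd_add hD hE
  smul_mem' c D hD := by simpa [Algebra.smul_def] using Dvd.dvd.mul_left hD _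
  lie_mem' {D E} hD hE := by
    change _ ∣ ⁅D, E⁆ (t f p)
    rw [Derivation.commutator_apply]
    exact dvd_sub (hD.trans (apply_t_dvd D _)) (hE.trans (apply_t_dvd E _))

/-- `L_n` as a Lie ideal of `L_m`, for `m ≤ n`. -/
def Lideal (m n : ℕ) : LieIdeal f (L f p m) where
  carrier := {D | (D : W f p) ∈ L f p n}
  zero_mem' := (L f p n).zero_mem
  add_mem' hD hE := (L f p n).add_mem hD hE
  smul_mem' c _ hD := (L f p n).smul_mem c hD
  lie_mem {D E} hE := by
    change _ ∣ ⁅(D : W f p), (E : W f p)⁆ (t f p)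
    rw [Derivation.commutator_apply]
    exact dvd_sub (pow_dvd_of_pow_dvd _ D.2 hE) (Dvd.dvd.trans hE (apply_t_dvd _ _))

/-- The Lie algebra `L_{mn} = L_m / L_n`, for `m ≤ n`. -/
abbrev Lq (m n : ℕ) : Type _ := L f p m ⧸ Lideal f p m n

/-- The natural action of an automorphism `g` on derivations, `D ↦ g ∘ D ∘ g⁻¹`. -/
def conj (g : Aut f p) : W f p →ₗ[f] W f p where
  toFun D := Derivation.mk' (g.toLinearMap ∘ₗ (D : Trunc f p →ₗ[f] Trunc f p) ∘ₗ
    (g⁻¹ : Aut f p).toLinearMap) fun a b => by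
      have h (x : Trunc f p) : g (g⁻¹ x) = x := g.apply_symm_apply x
      simp only [LinearMap.comp_apply, AlgEquiv.toLinearMap_apply, Derivation.coeFn_coe, map_mul,
        Derivation.leibniz, smul_eq_mul, map_add, h]
  map_add' D E := Derivation.ext fun a => map_add g (D (g⁻¹ a)) (E (g⁻¹ a))
  map_smul' c D := Derivation.ext fun a => map_smul g c (D (g⁻¹ a))

variable {f p}

theorem conj_apply (g : Aut f p) (D : W f p) (a : Trunc f p) :
    conj f p g D a = g (D (g⁻¹ a)) := rfl

theorem conj_mem (g : Aut f p) {n : ℕ} {D : W f p} (hD : D ∈ L f p n) : conj f p g D ∈ L f p n := by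
  change _ ∣ conj f p g D (t f p)
  rw [conj_apply]
  exact pow_dvd_map g (Dvd.dvd.trans hD (apply_t_dvd _ _))

theorem conj_sub_mem {g : Aut f p} {m n : ℕ} (hg : g ∈ G f p n) {D : W f p} (hD : D ∈ L f p m) :
    conj f p g D - D ∈ L f p n := by
  change _ ∣ conj f p g D (t f p) - D (t f p)
  rw [conj_apply]
  have h1 := pow_dvd_sub g hg (D (g⁻¹ (t f p)))
  have h2 := pow_dvd_of_pow_dvd D hD ((G f p n).inv_mem hg)
  rw [map_sub] at h2
  simpa using dvd_add h1 h2

variable (f p)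

/-- The adjoint representation of `G_m` on `L_m`. -/
def Ad (m : ℕ) : Representation f (G f p m) (L f p m) where
  toFun g := (conj f p g).restrict (p := (L f p m).toSubmodule) (q := (L f p m).toSubmodule)
    fun _ hD => conj_mem g.1 hD
  map_one' := by ext; rfl
  map_mul' _ _ := by ext; rfl

/-- The adjoint representation of `G_{mn}` on `L_{mn}`: the class of `g` takes the class of `D` to
the class of `g ∘ D ∘ g⁻¹`. -/
def Adq (m n : ℕ) : Representation f (Gq f p m n) (Lq f p m n) :=
  QuotientGroup.lift ((G f p n).subgroupOf (G f p m))
    { toFun := fun g => Submodule.mapQ (Lideal f p m n).toSubmodule (Lideal f p m n).toSubmodule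
        (Ad f p m g) fun _ hD => conj_mem g.1 hD
      map_one' := by
        apply Submodule.linearMap_qext
        ext D
        simp
      map_mul' := fun g h => by
        apply Submodule.linearMap_qext
        exact LinearMap.ext fun D => congrArg (Lideal f p m n).toSubmodule.mkQ
          (LinearMap.congr_fun (map_mul (Ad f p m) g h) D) }
    (by
      intro g hg
      apply Submodule.linearMap_qext
      ext D
      exact (Submodule.Quotient.eq _).mpr (conj_sub_mem hg D.2))

/-- The coadjoint representation of `G_m` on the dual space of `L_m`. -/
def Coad (m : ℕ) : Representation f (G f p m) (Module.Dual f (L f p m)) :=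
  (Ad f p m).dual

/-- The coadjoint representation of `G_{mn}` on the dual space of `L_{mn}`. -/
def Coadq (m n : ℕ) : Representation f (Gq f p m n) (Module.Dual f (Lq f p m n)) :=
  (Adq f p m n).dual

/-- `O` is an orbit of a representation. -/
def IsOrbit {f Γ V : Type*} [Field f] [Group Γ] [AddCommGroup V] [Module f V]
    (ρ : Representation f Γ V) (O : Set V) : Prop :=
  ∃ v : V, O = Set.range fun g : Γ => ρ g v

/-- The canonical projection `L_m → L_{mn}`. -/
def proj (m n : ℕ) : L f p m →ₗ[f] Lq f p m n := (Lideal f p m n).toSubmodule.mkQ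

variable {n i : ℕ} in
/-- The canonical projection `L_{mi} → L_{mn}`, for `n ≤ i`. -/
def projq (m : ℕ) (h : n ≤ i) : Lq f p m i →ₗ[f] Lq f p m n :=
  Submodule.mapQ (Lideal f p m i).toSubmodule (Lideal f p m n).toSubmodule LinearMap.id
    fun _ hD => (pow_dvd_pow (t f p) (Nat.add_le_add_right h 1)).trans hD

/-- The canonical inclusion `L_{mn}^* → L_m^*`. -/
def incl (m n : ℕ) : Module.Dual f (Lq f p m n) →ₗ[f] Module.Dual f (L f p m) :=
  (proj f p m n).dualMap

variable {n i : ℕ} in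
/-- The canonical inclusion `L_{mn}^* → L_{mi}^*`, for `n ≤ i`. -/
def inclq (m : ℕ) (h : n ≤ i) : Module.Dual f (Lq f p m n) →ₗ[f] Module.Dual f (Lq f p m i) :=
  (projq f p m h).dualMap

variable [CharP f p]

theorem mk_derivative_eq_zero (q : Polynomial f)
    (hq : Ideal.Quotient.mkₐ f (Ideal.span {(Polynomial.X ^ p : Polynomial f)}) q = 0) :
    Ideal.Quotient.mkₐ f (Ideal.span {(Polynomial.X ^ p : Polynomial f)})
      (Polynomial.derivative' q) = 0 := by
  have h : (Polynomial.X ^ p : Polynomial f) ∣ q :=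
    Ideal.mem_span_singleton.mp (Ideal.Quotient.eq_zero_iff_mem.mp hq)
  obtain ⟨r, rfl⟩ := h
  refine Ideal.Quotient.eq_zero_iff_mem.mpr (Ideal.mem_span_singleton.mpr ?_)
  simp

/-- The derivation `d/dt` of `f[t] / (t ^ p)`. -/
def ddt : W f p :=
  Derivation.liftOfSurjective
    (f := (Ideal.Quotient.mkₐ f (Ideal.span {(Polynomial.X ^ p : Polynomial f)}) :
      Polynomial f →ₐ[f] Trunc f p))
    (Ideal.Quotient.mkₐ_surjective _ _) (mk_derivative_eq_zero f p)

theorem ddt_t : ddt f p (t f p) = 1 := by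
  refine (Derivation.liftOfSurjective_apply
    (f := (Ideal.Quotient.mkₐ f (Ideal.span {(Polynomial.X ^ p : Polynomial f)}) :
      Polynomial f →ₐ[f] Trunc f p)) (Ideal.Quotient.mkₐ_surjective _ _)
      (mk_derivative_eq_zero f p) Polynomial.X).trans ?_
  rw [Polynomial.derivative'_apply, Polynomial.derivative_X]
  exact map_one _

/-- The derivation `l_i = t ^ (i + 1) d/dt`, for `i ≥ 0`. -/
def l (i : ℕ) : W f p := t f p ^ (i + 1) • ddt f p

variable {f p} in
theorem l_mem {m i : ℕ} (h : m ≤ i) : l f p i ∈ L f p m := by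
  change _ ∣ t f p ^ (i + 1) • ddt f p (t f p)
  rw [ddt_t, smul_eq_mul, mul_one]
  exact pow_dvd_pow _ (by omega)

variable {m i : ℕ} in
/-- The class of `l_i` in `L_{mn}`, for `i ≥ m`. -/
def lq (n : ℕ) (h : m ≤ i) : Lq f p m n := proj f p m n ⟨l f p i, l_mem h⟩

/-- A linear form on `L_{m+1,n+1}` is in a general position if `n ≤ 2m + 2`, or `n > 2m + 2` and
its value at `l_n` is not `0`. -/
def InGeneralPosition (m n : ℕ) (ξ : Module.Dual f (Lq f p (m + 1) (n + 1))) : Prop :=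
  ∀ h : 2 * m + 2 < n, ξ (lq f p (n + 1) (show m + 1 ≤ n by omega)) ≠ 0

/-- `O` is an orbit in a general position of the coadjoint representation of `G_{m+1,n+1}`. -/
def IsGeneralOrbit (m n : ℕ) (O : Set (Module.Dual f (Lq f p (m + 1) (n + 1)))) : Prop :=
  IsOrbit (Coadq f p (m + 1) (n + 1)) O ∧ ∀ ξ ∈ O, InGeneralPosition f p m n ξ

/-- The polynomial functions on `L_{m+1,n+1}^*`: the polynomials in `l_{m+1}, …, l_n`. -/
abbrev Fun (f : Type*) [Field f] (m n : ℕ) : Type _ := MvPolynomial (Finset.Icc (m + 1) n) f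

/-- The value of a polynomial function at a linear form. -/
def value {m n : ℕ} (ξ : Module.Dual f (Lq f p (m + 1) (n + 1))) (q : Fun f m n) : f :=
  MvPolynomial.eval (fun j => ξ (lq f p (n + 1) (Finset.mem_Icc.mp j.2).1)) q

/-- The set of the common zeros in `L_{m+1,n+1}^*` of a set of polynomial functions. -/
def locus {m n : ℕ} (E : Set (Fun f m n)) : Set (Module.Dual f (Lq f p (m + 1) (n + 1))) :=
  {ξ | ∀ q ∈ E, value f p ξ q = 0}

end Groups

section Equations

variable (f : Type*) [Field f]

/-- The coordinate function `l_j` on `L_{m+1,n+1}^*`, for `m + 1 ≤ j ≤ n`. -/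
def lfun (m n j : ℕ) : Fun f m n :=
  if h : j ∈ Finset.Icc (m + 1) n then MvPolynomial.X ⟨j, h⟩ else 0

/-- The equations `l_n = c_0, l_{n-1} = c_1, …, l_{n-m} = c_m`. -/
def oddEquations (m n : ℕ) (c : Fin (m + 1) → f) : Set (Fun f m n) :=
  Set.range fun i : Fin (m + 1) => lfun f m n (n - i) - MvPolynomial.C (c i)

/-- The equations `l_n = c_0, l_{n-1} = c_1, …, l_{n-m} = c_m` and
`P_{mk}(l_n, l_{n-1}, …, l_{n/2}) = c_{m+1}`, where `k = n/2 - m`. -/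
def evenEquations (m n : ℕ) (c : Fin (m + 2) → f) : Set (Fun f m n) :=
  insert
    (MvPolynomial.aeval (fun i => lfun f m n (n - i)) (P f m (n / 2 - m)) -
      MvPolynomial.C (c (Fin.last (m + 1))))
    (oddEquations f m n fun i => c i.castSucc)

end Equations

end TruncatedLine

end

/-! Linear forms are quadratic differentials. Pairing `a d/dt` with `U (dt) ^ 2` by the residue of
`a U dt`, the coefficient of `t ^ (p - 1)`, identifies `L_{m+1}^*` with the `U` modulo `t ^ (p - 2 -
m)` (`form_surjective`, `form_succ_eq_iff`). Here `l_i` reads off the coefficient of `t ^ (p - 2 -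
i)`, so `L_{m+1,n+1}^*` consists of the `U` of order at least `a = p - 2 - n`. Residues are
invariant under substitutions (`coef_map_mul_ddt`), hence the coadjoint action becomes `U ↦ g(U)
g(t)' ^ 2` (`Coad_form`).

One first-order computation, `exists_act_eq`, governs the orbits: the substitution `t + b t ^ (j +
1) + ⋯` fixes the coefficients of `U` below `t ^ (a + j)` and adds `(a + 2 (j + 1)) b U_a` to that
one. In `G_{m+1}` only `j ≥ m + 1` occurs. So `l_n, …, l_{n-m}` are invariant when `n > 2m + 2`, and
nothing moves when `n ≤ 2m + 2`. If `n > 2m + 2` and `U_a ≠ 0`, successive approximation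
(`exists_act_pow_dvd`) adjusts each later coefficient, except where the factor `p + 2j - n` vanishes
in `f`, that is, at `2j = n`. For odd `n` there is no obstruction; for even `n` the obstruction is
an invariant, the residue of `√U dt` (`sqrtCoeff_act`).

With `l_n ≠ 0, …, l_{n-m}` fixed, `P_{mk}` separates the same points as this residue
(`aeval_P_eq_iff`). It has degree one in `l_{n/2}`, with coefficient `l_n ^ (k - 1) / 2`
(`aeval_P_eq_add`); eliminating `l_{n/2}` shows that all parameters occur and that the equations
generate a prime ideal. Passing between different `n` is equivariance of the inclusions
(`incl_image_orbit`) together with the choice of the leading term of `U` (`exists_leading`). -/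

noncomputable section

namespace TruncatedLine

/-! ### Coefficients of truncated polynomials. -/

section Coefficients

variable {f : Type*} [Field f] {p : ℕ}

/-- The coefficient of `t ^ k`, for `k < p`. -/
def coef (k : ℕ) : Trunc f p →ₗ[f] f :=
  Polynomial.lcoeff f k ∘ₗ AdjoinRoot.modByMonicHom (Polynomial.monic_X_pow p)

theorem coef_aeval {k : ℕ} (hk : k < p) (q : Polynomial f) :
    coef k (Polynomial.aeval (t f p) q) = q.coeff k := by
  rw [← mk_eq_aeval]
  change (AdjoinRoot.modByMonicHom (Polynomial.monic_X_pow p) (AdjoinRoot.mk _ q)).coeff k = _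
  rw [AdjoinRoot.modByMonicHom_mk]
  conv_rhs => rw [← Polynomial.modByMonic_add_div q (Polynomial.X ^ p : Polynomial f)]
  rw [Polynomial.coeff_add, Polynomial.coeff_X_pow_mul', if_neg (by omega), add_zero]

theorem coef_mul {k : ℕ} (hk : k < p) (a b : Trunc f p) :
    coef k (a * b) = ∑ x ∈ Finset.HasAntidiagonal.antidiagonal k, coef x.1 a * coef x.2 b := by
  obtain ⟨q, rfl⟩ := exists_aeval a
  obtain ⟨r, rfl⟩ := exists_aeval b
  rw [← map_mul, coef_aeval hk, Polynomial.coeff_mul]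
  refine Finset.sum_congr rfl fun x hx => ?_
  have := Finset.HasAntidiagonal.mem_antidiagonal.mp hx
  rw [coef_aeval (by omega), coef_aeval (by omega)]

theorem pow_dvd_iff {n : ℕ} (hn : n ≤ p) {a : Trunc f p} :
    t f p ^ n ∣ a ↔ ∀ k < n, coef k a = 0 := by
  obtain ⟨q, rfl⟩ := exists_aeval a
  constructor
  · rintro ⟨b, hb⟩ k hk
    obtain ⟨r, rfl⟩ := exists_aeval b
    rw [hb, ← Polynomial.aeval_X (R := f) (t f p), ← map_pow, Polynomial.aeval_X, ← map_mul,
      coef_aeval (by omega), Polynomial.coeff_X_pow_mul', if_neg (by omega)]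
  · intro h
    have h' : (Polynomial.X ^ n : Polynomial f) ∣ q := Polynomial.X_pow_dvd_iff.mpr fun k hk => by
      rw [← coef_aeval (p := p) (by omega) q, h k hk]
    simpa using map_dvd (Polynomial.aeval (t f p)) h'

theorem coef_congr {n k : ℕ} (hn : n ≤ p) (hk : k < n) {a b : Trunc f p}
    (h : t f p ^ n ∣ a - b) : coef k a = coef k b := by
  have := (pow_dvd_iff hn).mp h k hk
  rwa [map_sub, sub_eq_zero] at this

theorem coef_ext {a b : Trunc f p} (h : ∀ k < p, coef k a = coef k b) : a = b := by
  have : t f p ^ p ∣ a - b := (pow_dvd_iff le_rfl).mpr fun k hk => by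
    rw [map_sub, h k hk, sub_self]
  rw [t_pow, zero_dvd_iff, sub_eq_zero] at this
  exact this

theorem coef_t_pow_mul {k n : ℕ} (hk : k + n < p) (a : Trunc f p) :
    coef (k + n) (t f p ^ n * a) = coef k a := by
  obtain ⟨q, rfl⟩ := exists_aeval a
  have : t f p ^ n * Polynomial.aeval (t f p) q =
      Polynomial.aeval (t f p) (Polynomial.X ^ n * q) := by simp
  rw [this, coef_aeval hk, Polynomial.coeff_X_pow_mul, coef_aeval (by omega)]

theorem coef_algebraMap {k : ℕ} (hk : k < p) (c : f) :
    coef k (algebraMap f (Trunc f p) c) = if k = 0 then c else 0 := by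
  rw [← Polynomial.aeval_C (R := f) (t f p), coef_aeval hk, Polynomial.coeff_C]

theorem coef_one {k : ℕ} (hk : k < p) : coef k (1 : Trunc f p) = if k = 0 then 1 else 0 := by
  rw [← map_one (algebraMap f (Trunc f p)), coef_algebraMap hk]

theorem coef_algebraMap_mul (k : ℕ) (c : f) (a : Trunc f p) :
    coef k (algebraMap f (Trunc f p) c * a) = c * coef k a := by
  rw [← Algebra.smul_def, map_smul, smul_eq_mul]

theorem coef_zero_mul (hp : 0 < p) (a b : Trunc f p) :
    coef 0 (a * b) = coef 0 a * coef 0 b := by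
  rw [coef_mul hp, Finset.Nat.antidiagonal_zero, Finset.sum_singleton]

theorem coef_zero_pow (hp : 0 < p) (a : Trunc f p) (n : ℕ) :
    coef 0 (a ^ n) = coef 0 a ^ n := by
  induction n with
  | zero => rw [pow_zero, pow_zero, coef_one hp, if_pos rfl]
  | succ n ih => rw [pow_succ, coef_zero_mul hp, ih, pow_succ]

theorem exists_coef_zero_add (hp : 0 < p) (a : Trunc f p) :
    ∃ b : Trunc f p, a = algebraMap f _ (coef 0 a) + t f p * b := by
  obtain ⟨c, b, h⟩ := exists_const_add a
  refine ⟨b, ?_⟩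
  have : coef 0 a = c := by
    have h0 : coef 0 (t f p * b) = 0 :=
      (pow_dvd_iff (n := 1) hp).mp (by rw [pow_one]; exact dvd_mul_right _ _) 0 one_pos
    rw [h, map_add, coef_algebraMap hp, h0]
    simp
  rw [this]; exact h

/-- The element with the coefficients `x 0, x 1, …, x (p - 1)`. -/
def ofCoef (x : ℕ → f) : Trunc f p :=
  Polynomial.aeval (t f p) (∑ i ∈ Finset.range p, Polynomial.monomial i (x i))

theorem coef_ofCoef {k : ℕ} (hk : k < p) (x : ℕ → f) : coef k (ofCoef x : Trunc f p) = x k := by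
  rw [ofCoef, coef_aeval hk, Polynomial.finsetSum_coeff]
  simp [Polynomial.coeff_monomial, hk]

end Coefficients

/-! ### Derivatives, the chain rule and invariance of residues. -/

section Calculus

variable {f : Type*} [Field f] {p : ℕ} [CharP f p]

theorem derivation_apply (D : W f p) (a : Trunc f p) : D a = D (t f p) * ddt f p a := by
  obtain ⟨q, rfl⟩ := exists_aeval a
  rw [Derivation.map_aeval, Derivation.map_aeval, ddt_t]
  simp [mul_comm]

theorem derivation_ext {D E : W f p} (h : D (t f p) = E (t f p)) : D = E :=
  Derivation.ext fun a => by rw [derivation_apply D, derivation_apply E, h]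

theorem coef_ddt {k : ℕ} (hk : k + 1 < p) (a : Trunc f p) :
    coef k (ddt f p a) = (k + 1) * coef (k + 1) a := by
  obtain ⟨q, rfl⟩ := exists_aeval a
  rw [Derivation.map_aeval, ddt_t, smul_eq_mul, mul_one, coef_aeval (by omega), coef_aeval hk,
    Polynomial.coeff_derivative, mul_comm]

/-- Exact differentials have residue zero: this coefficient of the derivative carries the factor
`p`. -/
theorem coef_last_ddt (hp : 0 < p) (a : Trunc f p) : coef (p - 1) (ddt f p a) = 0 := by
  obtain ⟨q, rfl⟩ := exists_aeval a
  rw [Derivation.map_aeval, ddt_t, smul_eq_mul, mul_one, coef_aeval (by omega),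
    Polynomial.coeff_derivative, ← Nat.cast_succ, Nat.succ_eq_add_one, Nat.sub_add_cancel hp,
    CharP.cast_eq_zero, mul_zero]

/-- The chain rule. Conjugating `d/dt` by `g⁻¹` gives a derivation, hence a multiple of `d/dt`
determined by its value at `t`. -/
theorem ddt_map (g : Aut f p) (a : Trunc f p) :
    ddt f p (g a) = g (ddt f p a) * ddt f p (g (t f p)) := by
  have h (b : Trunc f p) : g (g⁻¹ b) = b := g.apply_symm_apply b
  have h' (b : Trunc f p) : g⁻¹ (g b) = b := g.symm_apply_apply b
  have h1 := derivation_apply (conj f p g⁻¹ (ddt f p)) a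
  rw [conj_apply, conj_apply, inv_inv] at h1
  have h2 := congrArg g h1
  rw [map_mul, h, h] at h2
  rw [h2, mul_comm]

/-- Termwise integration: among the exponents below `p`, only `p - 1` requires division by zero in
`f`. -/
theorem exists_eq_ddt_add (hp : p.Prime) (w : Trunc f p) :
    ∃ b : Trunc f p, w = ddt f p b + algebraMap f _ (coef (p - 1) w) * t f p ^ (p - 1) := by
  -- At `k = 0` this is a division by zero; the constant of integration is irrelevant.
  refine ⟨ofCoef fun k => coef (k - 1) w / k, coef_ext fun k hk => ?_⟩
  have ht : coef k (t f p ^ (p - 1)) = if k = p - 1 then (1 : f) else 0 := by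
    have : t f p ^ (p - 1) = Polynomial.aeval (t f p) (Polynomial.X ^ (p - 1) : Polynomial f) := by
      simp
    rw [this, coef_aeval hk, Polynomial.coeff_X_pow]
  rw [map_add, coef_algebraMap_mul, ht]
  by_cases h : k = p - 1
  · rw [h, if_pos rfl, coef_last_ddt hp.pos, zero_add, mul_one]
  · have hk' : k + 1 < p := by omega
    have h0 : ((k : f) + 1) ≠ 0 := by
      rw [← Nat.cast_succ, Ne, CharP.cast_eq_zero_iff f p]
      exact fun hd => absurd (Nat.le_of_dvd (Nat.succ_pos _) hd) (by simpa using hk')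
    rw [if_neg h, coef_ddt hk', coef_ofCoef hk', Nat.add_sub_cancel, Nat.cast_succ]
    field_simp
    simp

theorem t_dvd_ddt_sub_one {g : Aut f p} (hg : g ∈ G f p 1) :
    t f p ∣ ddt f p (g (t f p)) - 1 := by
  obtain ⟨c, hc⟩ : t f p ^ 2 ∣ g (t f p) - t f p := hg
  rw [sub_eq_iff_eq_add.mp hc, map_add, ddt_t, Derivation.leibniz, Derivation.leibniz_pow, ddt_t]
  simp only [smul_eq_mul, nsmul_eq_mul]
  exact ⟨t f p * ddt f p c + c * 2, by push_cast; ring⟩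

/-- A substitution `t ↦ g(t)` with `g(t) = t + o(t)` preserves the residue of a differential. -/
theorem coef_map_mul_ddt (hp : p.Prime) {g : Aut f p} (hg : g ∈ G f p 1) (w : Trunc f p) :
    coef (p - 1) (g w * ddt f p (g (t f p))) = coef (p - 1) w := by
  obtain ⟨b, hb⟩ := exists_eq_ddt_add hp w
  have hg' : t f p ^ 2 ∣ g (t f p) - t f p := hg
  obtain ⟨c, hc⟩ := hg'
  have hd := t_dvd_ddt_sub_one hg
  -- The differential `t ^ (p - 1) dt` is fixed, since every correction is a multiple of `t ^ p =
  -- 0`; the exact part stays exact by the chain rule.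
  have h2 : g (t f p ^ (p - 1)) * ddt f p (g (t f p)) = t f p ^ (p - 1) := by
    obtain ⟨e, he⟩ := hd
    have hv : g (t f p) = t f p * (1 + t f p * c) := by rw [sub_eq_iff_eq_add.mp hc]; ring
    have ht : t f p ^ (p - 1) * t f p = 0 := by
      rw [← pow_succ, Nat.sub_add_cancel hp.pos, t_pow]
    obtain ⟨r, hr⟩ : t f p ∣ (1 + t f p * c) ^ (p - 1) - 1 := by
      refine Dvd.dvd.trans ⟨c, ?_⟩ (sub_one_dvd_pow_sub_one _ (p - 1))
      ring
    rw [map_pow, hv, mul_pow, sub_eq_iff_eq_add.mp hr, ← hv, sub_eq_iff_eq_add.mp he]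
    linear_combination (t f p * r * e + e + r) * ht
  conv_lhs => rw [hb]
  rw [map_add, add_mul, ← ddt_map, map_add, coef_last_ddt hp.pos, zero_add, map_mul g,
    AlgEquiv.commutes, mul_assoc, h2, coef_algebraMap_mul]
  have := coef_t_pow_mul (f := f) (p := p) (k := 0) (n := p - 1) (by have := hp.pos; omega) 1
  rw [zero_add, mul_one, coef_one hp.pos, if_pos rfl] at this
  rw [this, mul_one]

end Calculus

/-! ### Substitutions as automorphisms. -/

section Automorphisms

variable {f : Type*} [Field f] {p : ℕ}

theorem coef_t {k : ℕ} (hk : k < p) : coef k (t f p) = if k = 1 then 1 else 0 := by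
  rw [← Polynomial.aeval_X (R := f) (t f p), coef_aeval hk, Polynomial.coeff_X]
  simp only [eq_comm]

theorem G_le {m n : ℕ} (h : m ≤ n) : G f p n ≤ G f p m := fun _ hg =>
  (pow_dvd_pow (t f p) (Nat.add_le_add_right h 1)).trans hg

/-- An endomorphism `t ↦ t + o(t)` of the truncated polynomial algebra is bijective. -/
theorem bijective_of_sq_dvd (φ : Trunc f p →ₐ[f] Trunc f p)
    (h : t f p ^ 2 ∣ φ (t f p) - t f p) : Function.Bijective φ := by
  obtain ⟨c, hc⟩ := h
  have hv : φ (t f p) = t f p * (1 + t f p * c) := by rw [sub_eq_iff_eq_add.mp hc]; ring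
  have h1 (a : Trunc f p) : t f p ∣ φ a - a := by
    obtain ⟨q, rfl⟩ := exists_aeval a
    rw [← Polynomial.aeval_algHom_apply, Polynomial.aeval_def, Polynomial.aeval_def,
      ← Polynomial.eval_map, ← Polynomial.eval_map]
    refine Dvd.dvd.trans ?_ (Polynomial.sub_dvd_eval_sub _ _ _)
    rw [hc, pow_two, mul_assoc]
    exact dvd_mul_right _ _
  -- `φ - 1` raises the order by at least one, so it is nilpotent and `φ` is invertible.
  set N : Module.End f (Trunc f p) := φ.toLinearMap - 1 with hN
  have hN' (a : Trunc f p) : N a = φ a - a := rfl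
  have h2 (k : ℕ) (a : Trunc f p) : t f p ^ k ∣ (N ^ k) a := by
    induction k with
    | zero => simp
    | succ k ih =>
      obtain ⟨b, hb⟩ := ih
      rw [pow_succ' N, Module.End.mul_apply, hb, hN', map_mul, map_pow, hv, mul_pow]
      obtain ⟨r, hr⟩ : t f p ∣ (1 + t f p * c) ^ k - 1 :=
        Dvd.dvd.trans ⟨c, by ring⟩ (sub_one_dvd_pow_sub_one _ k)
      obtain ⟨s, hs⟩ := h1 b
      rw [sub_eq_iff_eq_add.mp hr, sub_eq_iff_eq_add.mp hs]
      exact ⟨r * (t f p * s + b) + s, by ring⟩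
  have h3 : IsNilpotent N := ⟨p, LinearMap.ext fun a => by
    have := h2 p a
    rwa [t_pow, zero_dvd_iff] at this⟩
  have h4 : IsUnit φ.toLinearMap := by
    have := h3.isUnit_one_add
    rwa [hN, add_sub_cancel] at this
  exact (Module.End.isUnit_iff _).mp h4

/-- These substitutions supply the correction at each stage of the successive approximation. -/
theorem exists_aut {j : ℕ} (hj : 1 ≤ j) (b : f) :
    ∃ g : Aut f p, g (t f p) = t f p + algebraMap f _ b * t f p ^ (j + 1) := by
  have h0 : Polynomial.eval₂ (algebraMap f (Trunc f p))
      (t f p + algebraMap f _ b * t f p ^ (j + 1)) (Polynomial.X ^ p : Polynomial f) = 0 := by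
    have : t f p + algebraMap f _ b * t f p ^ (j + 1) =
      t f p * (1 + algebraMap f _ b * t f p ^ j) := by ring
    rw [Polynomial.eval₂_X_pow, this, mul_pow, t_pow, zero_mul]
  let φ : Trunc f p →ₐ[f] Trunc f p :=
    AdjoinRoot.liftAlgHom (Polynomial.X ^ p : Polynomial f) (Algebra.ofId f (Trunc f p))
      (t f p + algebraMap f _ b * t f p ^ (j + 1)) h0
  have hφ : φ (t f p) = t f p + algebraMap f _ b * t f p ^ (j + 1) :=
    AdjoinRoot.liftAlgHom_root _ (Algebra.ofId f (Trunc f p)) _ h0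
  refine ⟨AlgEquiv.ofBijective φ (bijective_of_sq_dvd φ ?_), hφ⟩
  rw [hφ, add_sub_cancel_left]
  exact Dvd.dvd.mul_left (pow_dvd_pow _ (by omega)) _

end Automorphisms

/-! ### Quadratic differentials under substitutions. -/

section Action

variable {f : Type*} [Field f] {p : ℕ} [CharP f p]

/-- The action of the automorphism `g` on the quadratic differential `U (dt) ^ 2`. -/
def act (g : Aut f p) : Trunc f p →ₗ[f] Trunc f p :=
  LinearMap.mulRight f (ddt f p (g (t f p)) ^ 2) ∘ₗ g.toLinearMap

theorem act_apply (g : Aut f p) (U : Trunc f p) : act g U = g U * ddt f p (g (t f p)) ^ 2 := rfl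

theorem act_one (U : Trunc f p) : act (1 : Aut f p) U = U := by
  simp [act_apply, ddt_t]

theorem act_mul (g h : Aut f p) (U : Trunc f p) : act (g * h) U = act g (act h U) := by
  have (a : Trunc f p) : (g * h) a = g (h a) := rfl
  simp only [act_apply, this, map_mul, map_pow]
  rw [ddt_map g]
  ring

theorem pow_dvd_act {n : ℕ} (g : Aut f p) {U : Trunc f p} (h : t f p ^ n ∣ U) :
    t f p ^ n ∣ act g U :=
  (pow_dvd_map g h).mul_right _

theorem exists_one_add_pow {R : Type*} [CommRing R] (e : R) (n : ℕ) :
    ∃ q, (1 + e) ^ n = 1 + n * e + e ^ 2 * q := by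
  induction n with
  | zero => exact ⟨0, by simp⟩
  | succ n ih =>
    obtain ⟨q, hq⟩ := ih
    exact ⟨n + q + e * q, by rw [pow_succ, hq]; push_cast; ring⟩

/-- The variation of a quadratic differential of order `a` under a substitution
`t ↦ t + b t ^ (j + 1) + o(t ^ (j + 1))`. -/
theorem exists_act_eq (hp : 0 < p) {g : Aut f p} {a j : ℕ} (hj : 1 ≤ j) (hj' : j + 1 < p)
    (ha : a < p) (hg : g ∈ G f p j) {U : Trunc f p} (hU : t f p ^ a ∣ U) :
    ∃ R, act g U = U + t f p ^ (a + j) * algebraMap f _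
      ((a + 2 * (j + 1)) * coef (j + 1) (g (t f p)) * coef a U) + t f p ^ (a + j + 1) * R := by
  obtain ⟨β, hβ⟩ := hg
  obtain ⟨V, rfl⟩ := hU
  have hV : coef a (t f p ^ a * V) = coef 0 V := by
    have := coef_t_pow_mul (f := f) (p := p) (k := 0) (n := a) (by omega) V
    rwa [zero_add] at this
  have hb : coef (j + 1) (g (t f p)) = coef 0 β := by
    have := coef_t_pow_mul (f := f) (p := p) (k := 0) (n := j + 1) (by omega) β
    rw [sub_eq_iff_eq_add.mp hβ, map_add, coef_t hj', if_neg (by omega), add_zero]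
    rwa [zero_add] at this
  obtain ⟨V1, hV1⟩ := exists_coef_zero_add hp V
  obtain ⟨β1, hβ1⟩ := exists_coef_zero_add hp β
  obtain ⟨i, rfl⟩ := Nat.exists_eq_add_of_le' hj
  obtain ⟨r, hr⟩ := pow_dvd_sub g ⟨β, hβ⟩ V
  obtain ⟨q, hq⟩ := exists_one_add_pow (t f p ^ (i + 1) * β) a
  have hK : ddt f p (g (t f p)) = 1 + (i + 2) * t f p ^ (i + 1) * β +
      t f p ^ (i + 2) * ddt f p β := by
    rw [sub_eq_iff_eq_add.mp hβ, map_add, ddt_t, Derivation.leibniz, Derivation.leibniz_pow, ddt_t]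
    simp only [smul_eq_mul, nsmul_eq_mul, Nat.add_sub_cancel]
    push_cast
    ring
  have hgt : g (t f p) = t f p * (1 + t f p ^ (i + 1) * β) := by
    rw [sub_eq_iff_eq_add.mp hβ]; ring
  rw [hV, hb, act_apply, hK, map_mul, map_pow, hgt, mul_pow, hq, sub_eq_iff_eq_add.mp hr]
  simp only [map_mul, map_add, map_natCast, map_ofNat, map_one]
  set b0 := algebraMap f (Trunc f p) (coef 0 β)
  set V0 := algebraMap f (Trunc f p) (coef 0 V)
  set T := t f p
  -- Only the product of the constant terms of `V` and `β` matters to first order.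
  have e : V * β = V0 * b0 + T * (V1 * β + V0 * β1) := by
    linear_combination β * hV1 + V0 * hβ1
  -- The linear term has two sources: `g(t) ^ a` contributes `a`, and the squared derivative
  -- contributes `2 (j + 1) = 2 (i + 2)`.
  obtain ⟨A, hA⟩ : ∃ A, (1 + a * (T ^ (i + 1) * β) + (T ^ (i + 1) * β) ^ 2 * q) *
      (1 + (i + 2) * T ^ (i + 1) * β + T ^ (i + 2) * ddt f p β) ^ 2 =
        1 + (a + 2 * (i + 2)) * T ^ (i + 1) * β + T ^ (i + 2) * A := by
    obtain ⟨B, hB⟩ : ∃ B, (1 + (i + 2) * T ^ (i + 1) * β + T ^ (i + 2) * ddt f p β) ^ 2 =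
        1 + 2 * (i + 2) * T ^ (i + 1) * β + T ^ (i + 2) * B :=
      ⟨(i + 2) ^ 2 * T ^ i * β ^ 2 + 2 * ddt f p β + 2 * (i + 2) * T ^ (i + 1) * β * ddt f p β +
        T ^ (i + 2) * ddt f p β ^ 2, by ring⟩
    rw [hB]
    exact ⟨T ^ i * β ^ 2 * q * (1 + 2 * (i + 2) * T ^ (i + 1) * β + T ^ (i + 2) * B) +
      B * (1 + a * T ^ (i + 1) * β) + a * 2 * (i + 2) * T ^ i * β ^ 2, by ring⟩
  refine ⟨(a + 2 * (i + 2)) * (V1 * β + V0 * β1) + V * A +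
    r * (1 + (a + 2 * (i + 2)) * T ^ (i + 1) * β + T ^ (i + 2) * A), ?_⟩
  push_cast
  linear_combination T ^ a * (T ^ (i + 2) * r + V) * hA +
    (a + 2 * (i + 2)) * T ^ (a + i + 1) * e

end Action

/-! ### The residue pairing between derivations and quadratic differentials. -/

section Forms

variable {f : Type*} [Field f] {p : ℕ}

/-- The linear form `a d/dt ↦ res (a U)` on `L_m`; the residue is the coefficient of
`t ^ (p - 1)`. -/
def form (m : ℕ) : Trunc f p →ₗ[f] Module.Dual f (L f p m) where
  toFun U :=
    { toFun := fun D => coef (p - 1) ((D : W f p) (t f p) * U)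
      map_add' := fun D E => by simp [add_mul]
      map_smul' := fun c D => by simp }
  map_add' U V := by ext D; simp [mul_add]
  map_smul' c U := by ext D; simp

theorem form_apply (m : ℕ) (U : Trunc f p) (D : L f p m) :
    form m U D = coef (p - 1) ((D : W f p) (t f p) * U) := rfl

variable [CharP f p]

/-- Substituting `g` in the residue of `(g⁻¹ D g)(t) U dt` does not change it; one derivative factor
comes from `dt`, the other from the chain rule for `D (g t)`. -/
theorem Coad_form (hp : p.Prime) {m : ℕ} (hm : 1 ≤ m) (g : G f p m) (U : Trunc f p) :
    Coad f p m g (form m U) = form m (act g.1 U) := by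
  ext D
  have hD : Coad f p m g (form m U) D =
    coef (p - 1) (conj f p (g.1)⁻¹ (D : W f p) (t f p) * U) := rfl
  have h (b : Trunc f p) : g.1 ((g.1)⁻¹ b) = b := g.1.apply_symm_apply b
  rw [hD, form_apply, conj_apply, inv_inv, ← coef_map_mul_ddt hp (G_le hm g.2), map_mul g.1, h,
    derivation_apply D.1, act_apply]
  congr 1
  ring

theorem l_apply_t (i : ℕ) : l f p i (t f p) = t f p ^ (i + 1) := by
  change t f p ^ (i + 1) • ddt f p (t f p) = _
  rw [ddt_t, smul_eq_mul, mul_one]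

theorem form_l {m i : ℕ} (hmi : m ≤ i) (hi : i + 2 ≤ p) (U : Trunc f p) :
    form m U ⟨l f p i, l_mem hmi⟩ = coef (p - 2 - i) U := by
  rw [form_apply, l_apply_t]
  have : p - 1 = (p - 2 - i) + (i + 1) := by omega
  rw [this, coef_t_pow_mul (by omega)]

theorem form_eq_zero_iff {m : ℕ} (hm : m + 1 ≤ p) {U : Trunc f p} :
    form m U = 0 ↔ t f p ^ (p - 1 - m) ∣ U := by
  constructor
  · intro h
    refine (pow_dvd_iff (by omega)).mpr fun k hk => ?_
    have := form_l (f := f) (m := m) (i := p - 2 - k) (by omega) (by omega) U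
    rw [h, show p - 2 - (p - 2 - k) = k by omega] at this
    rw [← this]; rfl
  · intro h
    ext D
    rw [form_apply]
    have h1 : t f p ^ (m + 1) ∣ (D : W f p) (t f p) := D.2
    have h2 : t f p ^ p ∣ (D : W f p) (t f p) * U := by
      have := mul_dvd_mul h1 h
      rwa [← pow_add, show m + 1 + (p - 1 - m) = p by omega] at this
    rw [t_pow, zero_dvd_iff] at h2
    rw [h2, map_zero]; rfl

theorem form_eq_iff {m : ℕ} (hm : m + 1 ≤ p) {U V : Trunc f p} :
    form m U = form m V ↔ t f p ^ (p - 1 - m) ∣ U - V := by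
  rw [← form_eq_zero_iff hm, map_sub, sub_eq_zero]

theorem form_surjective {m : ℕ} (hm : m + 1 ≤ p) :
    Function.Surjective (form m : Trunc f p →ₗ[f] Module.Dual f (L f p m)) := by
  intro ξ
  set x : ℕ → f := fun i => if h : m ≤ i then ξ ⟨l f p i, l_mem h⟩ else 0 with hx
  -- At `k = p - 1` truncated subtraction gives a spurious value; it would pair only with the
  -- constant term of `D t`, which is zero on `L_m`.
  refine ⟨ofCoef fun k => x (p - 2 - k), ?_⟩
  ext D
  -- It suffices to compare the forms on the `l_i` with `m ≤ i ≤ p - 2`, which span `L_m`.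
  have hD : D = ∑ i ∈ (Finset.Ico m (p - 1)).attach,
      coef (i.1 + 1) ((D : W f p) (t f p)) •
        (⟨l f p i.1, l_mem (Finset.mem_Ico.mp i.2).1⟩ : L f p m) := by
    refine Subtype.ext (derivation_ext (coef_ext fun k hk => ?_))
    have e : ((∑ i ∈ (Finset.Ico m (p - 1)).attach, coef (i.1 + 1) ((D : W f p) (t f p)) •
        (⟨l f p i.1, l_mem (Finset.mem_Ico.mp i.2).1⟩ : L f p m) : L f p m) : W f p) (t f p) =
        ∑ i ∈ Finset.Ico m (p - 1), coef (i + 1) ((D : W f p) (t f p)) • t f p ^ (i + 1) := by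
      let ev : L f p m →ₗ[f] Trunc f p :=
        { toFun := fun E => (E : W f p) (t f p)
          map_add' := fun E F => by simp
          map_smul' := fun c E => by simp }
      change ev _ = _
      rw [← Finset.sum_attach (Finset.Ico m (p - 1)), map_sum]
      refine Finset.sum_congr rfl fun i _ => ?_
      rw [map_smul, ← l_apply_t]
      rfl
    rw [e, map_sum]
    have ht (i : ℕ) : coef k (t f p ^ i) = if k = i then (1 : f) else 0 := by
      rw [← Polynomial.coeff_X_pow, ← coef_aeval hk]; simp
    simp only [map_smul, ht, smul_eq_mul, mul_ite, mul_one, mul_zero]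
    by_cases hkm : k < m + 1
    · rw [(pow_dvd_iff hm).mp D.2 k hkm, Finset.sum_eq_zero]
      intro i hi
      rw [if_neg (by have := Finset.mem_Ico.mp hi; omega)]
    · rw [Finset.sum_eq_single (k - 1)]
      · rw [if_pos (by omega), show k - 1 + 1 = k by omega]
      · intro i _ hik
        rw [if_neg (by omega)]
      · intro h
        exact absurd (Finset.mem_Ico.mpr ⟨by omega, by omega⟩) h
  rw [hD, map_sum, map_sum]
  refine Finset.sum_congr rfl fun i _ => ?_
  have hi := Finset.mem_Ico.mp i.2
  rw [map_smul, map_smul, form_l hi.1 (by omega), coef_ofCoef (by omega),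
    show p - 2 - (p - 2 - i.1) = i.1 by omega, hx]
  simp only [dif_pos hi.1]

end Forms

/-! ### Duals of the quotients inside the dual of `L_m`. -/

section Inclusions

variable {f : Type*} [Field f] {p : ℕ}

theorem incl_injective (m n : ℕ) : Function.Injective (incl f p m n) :=
  LinearMap.dualMap_injective_of_surjective (Submodule.mkQ_surjective _)

theorem incl_apply {m n : ℕ} (ξ : Module.Dual f (Lq f p m n)) (D : L f p m) :
    incl f p m n ξ D = ξ (proj f p m n D) := rfl

theorem incl_lq {m n i : ℕ} (h : m ≤ i) (ξ : Module.Dual f (Lq f p m n)) [CharP f p] :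
    incl f p m n ξ ⟨l f p i, l_mem h⟩ = ξ (lq f p n h) := rfl

theorem incl_Coadq {m n : ℕ} (g : G f p m) (ξ : Module.Dual f (Lq f p m n)) :
    incl f p m n (Coadq f p m n (QuotientGroup.mk g) ξ) = Coad f p m g (incl f p m n ξ) := rfl

theorem incl_inclq {m n i : ℕ} (h : n ≤ i) (ξ : Module.Dual f (Lq f p m n)) :
    incl f p m i (inclq f p m h ξ) = incl f p m n ξ := rfl

/-- The inclusion is equivariant and every class in `G_{mn}` lifts to `G_m`, so an orbit goes onto a
whole orbit, not merely into one. -/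
theorem incl_image_orbit {m n : ℕ} (ξ : Module.Dual f (Lq f p m n)) :
    incl f p m n '' Set.range (fun g => Coadq f p m n g ξ) =
      Set.range fun g => Coad f p m g (incl f p m n ξ) := by
  ext η
  constructor
  · rintro ⟨_, ⟨g, rfl⟩, rfl⟩
    obtain ⟨g, rfl⟩ := QuotientGroup.mk_surjective g
    exact ⟨g, rfl⟩
  · rintro ⟨g, rfl⟩
    exact ⟨_, ⟨QuotientGroup.mk g, rfl⟩, rfl⟩

theorem inclq_image_orbit {m n i : ℕ} (h : n ≤ i) (ξ : Module.Dual f (Lq f p m n)) :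
    inclq f p m h '' Set.range (fun g => Coadq f p m n g ξ) =
      Set.range fun g => Coadq f p m i g (inclq f p m h ξ) := by
  refine (incl_injective m i).image_injective ?_
  rw [incl_image_orbit, ← Set.image_comp]
  exact incl_image_orbit ξ

/-- The order of `U` makes `a U` divisible by `t ^ p` for `a d/dt` in `L_n`, so the form descends to
the quotient. -/
theorem exists_incl_eq {m n : ℕ} (hn : n + 1 ≤ p) {U : Trunc f p}
    (hU : t f p ^ (p - 1 - n) ∣ U) : ∃ ξ, incl f p m n ξ = form m U := by
  refine ⟨(Lideal f p m n).toSubmodule.liftQ (form m U) fun D hD => ?_, rfl⟩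
  have h1 : t f p ^ (n + 1) ∣ (D : W f p) (t f p) := hD
  have h2 : t f p ^ p ∣ (D : W f p) (t f p) * U := by
    have := mul_dvd_mul h1 hU
    rwa [← pow_add, show n + 1 + (p - 1 - n) = p by omega] at this
  rw [t_pow, zero_dvd_iff] at h2
  rw [LinearMap.mem_ker, form_apply, h2, map_zero]

variable [CharP f p]

theorem exists_form_eq {m n : ℕ} (hmn : m ≤ n) (hn : n + 1 ≤ p) (ξ : Module.Dual f (Lq f p m n)) :
    ∃ U, t f p ^ (p - 1 - n) ∣ U ∧ incl f p m n ξ = form m U := by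
  obtain ⟨U, hU⟩ := form_surjective (show m + 1 ≤ p by omega) (incl f p m n ξ)
  refine ⟨U, (pow_dvd_iff (by omega)).mpr fun k hk => ?_, hU.symm⟩
  have h1 := form_l (f := f) (m := m) (i := p - 2 - k) (by omega) (by omega) U
  rw [show p - 2 - (p - 2 - k) = k by omega, hU, incl_apply] at h1
  rw [← h1]
  have : proj f p m n ⟨l f p (p - 2 - k), l_mem (by omega)⟩ = 0 :=
    (Submodule.Quotient.mk_eq_zero _).mpr (l_mem (f := f) (p := p) (show n ≤ p - 2 - k by omega))
  rw [this, map_zero]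

theorem apply_lq {m n i : ℕ} {ξ : Module.Dual f (Lq f p m n)} {U : Trunc f p}
    (h : incl f p m n ξ = form m U) (hmi : m ≤ i) (hi : i + 2 ≤ p) :
    ξ (lq f p n hmi) = coef (p - 2 - i) U := by
  rw [← incl_lq, h, form_l hmi hi]

theorem incl_Coadq_eq_form (hp : p.Prime) {m n : ℕ} (hm : 1 ≤ m) (g : G f p m)
    {ξ : Module.Dual f (Lq f p m n)} {U : Trunc f p} (h : incl f p m n ξ = form m U) :
    incl f p m n (Coadq f p m n (QuotientGroup.mk g) ξ) = form m (act g.1 U) := by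
  rw [incl_Coadq, h, Coad_form hp hm]

end Inclusions

/-! ### Moving the coefficients one at a time. -/

section Transitivity

variable {f : Type*} [Field f] {p : ℕ} [CharP f p]

theorem pow_dvd_act_sub (hp : 0 < p) {g : Aut f p} {a j : ℕ} (hj : 1 ≤ j) (hj' : j + 1 < p)
    (ha : a < p) (hg : g ∈ G f p j) {U : Trunc f p} (hU : t f p ^ a ∣ U) :
    t f p ^ (a + j) ∣ act g U - U := by
  obtain ⟨R, hR⟩ := exists_act_eq hp hj hj' ha hg hU
  rw [hR, add_assoc, add_sub_cancel_left]
  exact dvd_add (dvd_mul_right _ _) ((pow_dvd_pow _ (Nat.le_succ _)).mul_right _)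

/-- The first coefficient that could move is that of `t ^ (p - 2 - n + m + 1)`. For `n ≤ 2m + 1` it
already lies beyond the precision; for `n = 2m + 2` it is the last one visible, but its variation
has the factor `p = 0`. -/
theorem pow_dvd_act_sub_of_le {m n : ℕ} (hp : 0 < p) (hm : m + 2 ≤ p)
    (hn : n + 2 ≤ p) (h : n ≤ 2 * m + 2) {g : Aut f p} (hg : g ∈ G f p (m + 1)) {U : Trunc f p}
    (hU : t f p ^ (p - 2 - n) ∣ U) : t f p ^ (p - 2 - m) ∣ act g U - U := by
  rcases hm.eq_or_lt with h2 | h2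
  · rw [show p - 2 - m = 0 by omega, pow_zero]
    exact one_dvd _
  obtain ⟨R, hR⟩ := exists_act_eq hp (Nat.succ_pos m) (by omega) (by omega) hg hU
  rw [hR, add_assoc, add_sub_cancel_left]
  refine dvd_add ?_ ((pow_dvd_pow _ (by omega)).mul_right _)
  rcases h.eq_or_lt with h3 | h3
  · have : ((p - 2 - n : ℕ) : f) + 2 * ((m + 1 : ℕ) + 1) = 0 := by
      have h4 : (((p - 2 - n) + 2 * (m + 1 + 1) : ℕ) : f) = 0 := by
        rw [show (p - 2 - n) + 2 * (m + 1 + 1) = p by omega, CharP.cast_eq_zero]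
      push_cast at h4 ⊢
      exact h4
    rw [this, zero_mul, zero_mul, map_zero, mul_zero]
    exact dvd_zero _
  · exact (pow_dvd_pow _ (by omega)).mul_right _

/-- Successive approximation: two quadratic differentials with the same first coefficients are
conjugate, provided that the coefficients that cannot be changed coincide. -/
theorem exists_act_pow_dvd (hp : p.Prime) {m n : ℕ} (hmn : 2 * m + 2 < n) (hn : n + 2 ≤ p)
    {U V : Trunc f p} (hU : t f p ^ (p - 2 - n) ∣ U) (hU0 : coef (p - 2 - n) U ≠ 0)
    (hUV : t f p ^ (p - 2 - n + (m + 1)) ∣ U - V)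
    (H : ∀ j, 2 * j = n → ∀ g ∈ G f p (m + 1), t f p ^ (p - 2 - n + j) ∣ act g U - V →
      t f p ^ (p - 2 - n + j + 1) ∣ act g U - V) :
    ∃ g ∈ G f p (m + 1), t f p ^ (p - 2 - m) ∣ act g U - V := by
  have key : ∀ j, m + 1 ≤ j → j ≤ n - m →
      ∃ g ∈ G f p (m + 1), t f p ^ (p - 2 - n + j) ∣ act g U - V := by
    intro j hj
    induction j, hj using Nat.le_induction with
    | base => exact fun _ => ⟨1, one_mem _, by rwa [act_one]⟩
    | succ j hj ih =>
      intro hjn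
      obtain ⟨g, hg, hgU⟩ := ih (by omega)
      -- The one coefficient that cannot be adjusted; its agreement is the hypothesis `H`.
      by_cases hjn2 : 2 * j = n
      · exact ⟨g, hg, H j hjn2 g hg hgU⟩
      -- The integer is `p + 2j - n`, strictly between `0` and `2p`; it could only be divisible by
      -- `p` if `2j = n`.
      have hc : ((p - 2 - n : ℕ) : f) + 2 * ((j : f) + 1) ≠ 0 := by
        have : ((p - 2 - n : ℕ) : f) + 2 * ((j : f) + 1) =
            ((p - 2 - n + 2 * (j + 1) : ℕ) : f) := by push_cast; rfl
        rw [this, Ne, CharP.cast_eq_zero_iff f p]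
        rintro ⟨e, he⟩
        have h1 : e < 2 := by
          by_contra! h1
          have := Nat.mul_le_mul_left p h1
          omega
        interval_cases e <;> omega
      -- The leading coefficient is unchanged so far, hence still nonzero and usable as a divisor.
      have hx : coef (p - 2 - n) (act g U) = coef (p - 2 - n) U :=
        coef_congr (n := p - 2 - n + (m + 1)) (by omega) (by omega)
          (pow_dvd_act_sub hp.pos (Nat.succ_pos m) (by omega) (by omega) hg hU)
      set d := coef (p - 2 - n + j) (V - act g U) with hd
      -- The parameter solves the linear equation that makes the variation equal to the remaining
      -- discrepancy `d`.
      obtain ⟨h, hh⟩ := exists_aut (f := f) (p := p) (show 1 ≤ j by omega)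
        (d / (((p - 2 - n : ℕ) + 2 * (j + 1)) * coef (p - 2 - n) U))
      have hhG : h ∈ G f p j := by
        change t f p ^ (j + 1) ∣ h (t f p) - t f p
        rw [hh, add_sub_cancel_left]
        exact dvd_mul_left _ _
      obtain ⟨R, hR⟩ := exists_act_eq hp.pos (by omega) (by omega) (by omega) hhG
        (pow_dvd_act g hU)
      refine ⟨h * g, mul_mem (G_le hj hhG) hg, ?_⟩
      have hcoef : coef (j + 1) (h (t f p)) =
          d / (((p - 2 - n : ℕ) + 2 * (j + 1)) * coef (p - 2 - n) U) := by
        have := coef_t_pow_mul (f := f) (p := p) (k := 0) (n := j + 1) (by omega) 1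
        rw [zero_add, mul_one, coef_one hp.pos, if_pos rfl] at this
        rw [hh, map_add, coef_t (by omega), if_neg (by omega), coef_algebraMap_mul, this, zero_add,
          mul_one]
      obtain ⟨w, hw⟩ := hgU
      have hwd : coef 0 w = -d := by
        have := coef_t_pow_mul (f := f) (p := p) (k := 0) (n := p - 2 - n + j) (by omega) w
        rw [zero_add] at this
        rw [hd, ← this, ← hw, ← map_neg, neg_sub]
      obtain ⟨w', hw'⟩ := exists_coef_zero_add hp.pos w
      rw [hwd, map_neg] at hw'
      have hs : ((p - 2 - n : ℕ) + 2 * ((j : f) + 1)) *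
          (d / (((p - 2 - n : ℕ) + 2 * (j + 1)) * coef (p - 2 - n) U)) * coef (p - 2 - n) U = d := by
        field_simp
      rw [act_mul, hR, hcoef, hx, hs]
      refine ⟨w' + R, ?_⟩
      rw [← add_assoc]
      linear_combination hw + t f p ^ (p - 2 - n + j) * hw'
  obtain ⟨g, hg, h⟩ := key (n - m) (by omega) le_rfl
  exact ⟨g, hg, by rwa [show p - 2 - n + (n - m) = p - 2 - m by omega] at h⟩

end Transitivity

/-! ### Square roots of power series, coefficient by coefficient. -/

section SquareRoots

open Finset.HasAntidiagonal

variable {R : Type*} [CommRing R]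

theorem sqrtCoeff_congr (h : R) {a b : ℕ → R} (n : ℕ) (H : ∀ i, 1 ≤ i → i ≤ n → a i = b i) :
    sqrtCoeff h a n = sqrtCoeff h b n := by
  induction n using Nat.strong_induction_on with
  | _ n ih =>
    rcases n with _ | n
    · rw [sqrtCoeff, sqrtCoeff]
    · rw [sqrtCoeff, sqrtCoeff, H _ (Nat.succ_pos n) le_rfl]
      congr 2
      refine Finset.sum_congr rfl fun i _ => ?_
      rw [ih _ (by omega) fun j hj hj' => H j hj (by omega),
        ih _ (by omega) fun j hj hj' => H j hj (by omega)]

/-- The substitution `z ↦ c z` commutes with taking the square root. -/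
theorem sqrtCoeff_scale (h c : R) (a : ℕ → R) (n : ℕ) :
    sqrtCoeff h (fun k => c ^ k * a k) n = c ^ n * sqrtCoeff h a n := by
  induction n using Nat.strong_induction_on with
  | _ n ih =>
    rcases n with _ | n
    · rw [sqrtCoeff, sqrtCoeff, pow_zero, one_mul]
    · rw [sqrtCoeff, sqrtCoeff, mul_left_comm (c ^ (n + 1)), mul_sub (c ^ (n + 1)), Finset.mul_sum]
      congr 2
      refine Finset.sum_congr rfl fun i _ => ?_
      rw [ih _ (by omega), ih _ (by omega), show n + 1 = (i + 1) + (n - i) by omega, pow_add]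
      ring

theorem map_sqrtCoeff {S : Type*} [CommRing S] (φ : R →+* S) (h : R) (a : ℕ → R) (n : ℕ) :
    φ (sqrtCoeff h a n) = sqrtCoeff (φ h) (fun k => φ (a k)) n := by
  induction n using Nat.strong_induction_on with
  | _ n ih =>
    rcases n with _ | n
    · rw [sqrtCoeff, sqrtCoeff, map_one]
    · rw [sqrtCoeff, sqrtCoeff, map_mul, map_sub, map_sum]
      congr 2
      refine Finset.sum_congr rfl fun i _ => ?_
      rw [map_mul, ih _ (by omega), ih _ (by omega)]

theorem sum_antidiagonal_succ (w : ℕ → R) (hw : w 0 = 1) (n : ℕ) :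
    ∑ x ∈ antidiagonal (n + 1), w x.1 * w x.2 =
      2 * w (n + 1) + ∑ i : Fin n, w (i + 1) * w (n - i) := by
  rw [Finset.Nat.sum_antidiagonal_eq_sum_range_succ_mk, Finset.sum_range_succ',
    Finset.sum_range_succ, Finset.sum_range]
  simp only [Nat.sub_self, Nat.sub_zero, hw, Nat.add_sub_add_right]
  ring

theorem sum_sqrtCoeff_mul (h : R) (hh : h * 2 = 1) (a : ℕ → R) (n : ℕ) :
    ∑ x ∈ antidiagonal (n + 1), sqrtCoeff h a x.1 * sqrtCoeff h a x.2 = a (n + 1) := by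
  rw [sum_antidiagonal_succ _ (by rw [sqrtCoeff]), sqrtCoeff]
  linear_combination (a (n + 1) -
    ∑ i : Fin n, sqrtCoeff h a (i + 1) * sqrtCoeff h a (n - i)) * hh

/-- Uniqueness of the root: each equation determines `2 w n` from the earlier terms. Only finitely
many equations are needed, as befits truncated series. -/
theorem eq_sqrtCoeff (h : R) (hh : h * 2 = 1) {w a : ℕ → R} (hw : w 0 = 1) (n : ℕ)
    (H : ∀ k < n, ∑ x ∈ antidiagonal (k + 1), w x.1 * w x.2 = a (k + 1)) :
    w n = sqrtCoeff h a n := by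
  induction n using Nat.strong_induction_on with
  | _ n ih =>
    rcases n with _ | n
    · rw [sqrtCoeff, hw]
    · have e : ∑ i : Fin n, w (i + 1) * w (n - i) =
          ∑ i : Fin n, sqrtCoeff h a (i + 1) * sqrtCoeff h a (n - i) :=
        Finset.sum_congr rfl fun i _ => by
          rw [ih _ (by omega) fun k hk => H k (by omega),
            ih _ (by omega) fun k hk => H k (by omega)]
      have h1 := H n (Nat.lt_succ_self n)
      rw [sum_antidiagonal_succ w hw, e] at h1
      rw [sqrtCoeff, ← h1]
      linear_combination -w (n + 1) * hh

end SquareRoots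

/-! ### The residue of the square root of a quadratic differential. -/

section Invariant

variable {f : Type*} [Field f] {p : ℕ} [CharP f p]

/-- By Frobenius, since `t ^ p = 0`. Thus exponents of such units may be read modulo `p`, which
gives sense to their negative powers. -/
theorem one_add_t_mul_pow (hp : p.Prime) (c : Trunc f p) : (1 + t f p * c) ^ p = 1 := by
  have : Fact p.Prime := ⟨hp⟩
  have : CharP (Trunc f p) p := charP_of_injective_algebraMap
    (R := f) (A := Trunc f p) (fun a b hab => by
      have := congrArg (coef 0) hab
      rwa [coef_algebraMap hp.pos, coef_algebraMap hp.pos, if_pos rfl, if_pos rfl] at this) p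
  rw [add_pow_char, mul_pow, t_pow, one_pow, zero_mul, add_zero]

/-- The residue of the square root of a quadratic differential of even order is invariant. -/
theorem sqrtCoeff_act (hp : p.Prime) (h2 : (2 : f) ≠ 0) {N : ℕ} (hN : 2 * N + 2 ≤ p)
    {U : Trunc f p} (hU : t f p ^ (p - 2 - 2 * N) ∣ U) (hU0 : coef (p - 2 - 2 * N) U ≠ 0)
    {g : Aut f p} (hg : g ∈ G f p 1) :
    sqrtCoeff 2⁻¹ (fun i => coef (p - 2 - 2 * N + i) (act g U) /
      coef (p - 2 - 2 * N) (act g U)) N =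
    sqrtCoeff 2⁻¹ (fun i => coef (p - 2 - 2 * N + i) U / coef (p - 2 - 2 * N) U) N := by
  obtain ⟨a, ha⟩ : ∃ a, a = p - 2 - 2 * N := ⟨_, rfl⟩
  rw [← ha] at hU hU0 ⊢
  have hh : (2⁻¹ : f) * 2 = 1 := inv_mul_cancel₀ h2
  set x0 := coef a U with hx0
  set x : ℕ → f := fun i => coef (a + i) U / x0 with hx
  -- `W` is the root of the unit part, so that `U = x0 t ^ a W ^ 2`.
  set W : Trunc f p := ofCoef (sqrtCoeff 2⁻¹ x) with hW
  have hW0 : coef 0 W = 1 := by rw [hW, coef_ofCoef hp.pos, sqrtCoeff]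
  have hUW : U = algebraMap f _ x0 * (t f p ^ a * W ^ 2) := by
    refine coef_ext fun k hk => ?_
    rw [coef_algebraMap_mul]
    by_cases hka : k < a
    · rw [(pow_dvd_iff (by omega)).mp hU k hka,
        (pow_dvd_iff (n := a) (by omega)).mp (dvd_mul_right _ _) k hka, mul_zero]
    · obtain ⟨i, rfl⟩ := Nat.exists_eq_add_of_le (not_lt.mp hka)
      rw [add_comm a i, coef_t_pow_mul (by omega)]
      rcases i with _ | i
      · rw [coef_zero_pow hp.pos, hW0, zero_add]; simp [hx0]
      · rw [pow_two, coef_mul (by omega)]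
        have : ∑ z ∈ Finset.HasAntidiagonal.antidiagonal (i + 1), coef z.1 W * coef z.2 W =
            x (i + 1) := by
          rw [← sum_sqrtCoeff_mul _ hh x i]
          refine Finset.sum_congr rfl fun z hz => ?_
          have := Finset.HasAntidiagonal.mem_antidiagonal.mp hz
          rw [hW, coef_ofCoef (by omega), coef_ofCoef (by omega)]
        rw [this, add_comm (i + 1) a]
        change _ = x0 * (coef (a + (i + 1)) U / x0)
        field_simp
  have hK := t_dvd_ddt_sub_one hg
  have hg' : t f p ^ 2 ∣ g (t f p) - t f p := hg
  obtain ⟨c, hc⟩ := hg'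
  have hv : g (t f p) = t f p * (1 + t f p * c) := by rw [sub_eq_iff_eq_add.mp hc]; ring
  have hvp := one_add_t_mul_pow hp c
  set v := 1 + t f p * c with hvdef
  set K := ddt f p (g (t f p)) with hKdef
  -- `y` is the inverse of `v = g(t) / t`.
  set y := v ^ (p - 1) with hy
  have hyv : y * v = 1 := by rw [hy, ← pow_succ, Nat.sub_add_cancel hp.pos, hvp]
  have hyp : y ^ p = 1 := by rw [hy, ← pow_mul, mul_comm, pow_mul, hvp, one_pow]
  have hyt : y * g (t f p) = t f p := by rw [hv]; linear_combination t f p * hyv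
  -- The root of the transformed unit part: as `a = p - (2N + 2)`, the unit `v ^ a` is the square of
  -- `v ^ (-(N + 1))`.
  set W' := y ^ (N + 1) * g W * K with hW'
  have hva : v ^ a = (y ^ (N + 1)) ^ 2 := by
    have h1 : v ^ a * (v * y) ^ (2 * N + 2) = v ^ p * (y ^ (N + 1)) ^ 2 := by
      rw [mul_pow, ← mul_assoc, ← pow_add, show a + (2 * N + 2) = p by omega]
      ring
    rwa [mul_comm v, hyv, one_pow, mul_one, hvp, one_mul] at h1
  have hact : act g U = algebraMap f _ x0 * (t f p ^ a * W' ^ 2) := by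
    rw [act_apply]
    conv_lhs => rw [hUW]
    rw [map_mul, map_mul, AlgEquiv.commutes, map_pow, map_pow, hv, mul_pow, hva, ← hv, ← hKdef, hW']
    ring
  have h0 {u : Trunc f p} (hu : t f p ∣ u) : coef 0 u = 0 :=
    (pow_dvd_iff (n := 1) hp.pos).mp (by rwa [pow_one]) 0 one_pos
  have hv0 : coef 0 v = 1 := by
    rw [hvdef, map_add, h0 (dvd_mul_right _ _), coef_one hp.pos, if_pos rfl, add_zero]
  have hK0 : coef 0 K = 1 := by
    have := h0 hK
    rwa [map_sub, coef_one hp.pos, if_pos rfl, sub_eq_zero] at this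
  have hgW0 : coef 0 (g W) = 1 := by
    have := h0 ((dvd_pow_self _ two_ne_zero).trans (pow_dvd_sub g ⟨c, hc⟩ W))
    rwa [map_sub, hW0, sub_eq_zero] at this
  have hW'0 : coef 0 W' = 1 := by
    rw [hW', coef_zero_mul hp.pos, coef_zero_mul hp.pos, coef_zero_pow hp.pos, hy,
      coef_zero_pow hp.pos, hv0, hgW0, hK0]
    simp
  have hcoef {i : ℕ} (hi : a + i < p) :
      coef (a + i) (act g U) = x0 * coef i (W' ^ 2) := by
    rw [hact, coef_algebraMap_mul, add_comm a i, coef_t_pow_mul (by omega)]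
  have hact0 : coef a (act g U) = x0 := by
    have := hcoef (i := 0) (by omega)
    rwa [coef_zero_pow hp.pos, hW'0, one_pow, mul_one, add_zero] at this
  have h1 : coef N W' =
      sqrtCoeff 2⁻¹ (fun i => coef (a + i) (act g U) / coef a (act g U)) N := by
    refine eq_sqrtCoeff (w := fun i => coef i W') _ hh hW'0 N fun k hk => ?_
    rw [hact0, hcoef (by omega), pow_two, coef_mul (by omega)]
    field_simp
  -- The power `t ^ (p - 1 - N)` plays the role of `t ^ (-(N + 1))`: the coefficient of `t ^ N` in
  -- `W` is the residue of `t ^ (p - 1 - N) W dt`, and `g` takes this differential to the one formed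
  -- with `W'`.
  have h3 : coef N W' = coef N W := by
    rw [← coef_t_pow_mul (n := p - 1 - N) (by omega), ← coef_t_pow_mul (n := p - 1 - N)
      (by omega) W, show N + (p - 1 - N) = p - 1 by omega,
      ← coef_map_mul_ddt hp hg (_ * W)]
    congr 1
    have h4 : t f p ^ (p - 1 - N) * y ^ (N + 1) = g (t f p) ^ (p - 1 - N) := by
      conv_lhs => rw [← hyt]
      rw [mul_pow, mul_right_comm, ← pow_add, show p - 1 - N + (N + 1) = p by omega, hyp, one_mul]
    rw [map_mul, map_pow, ← h4, hW', ← hKdef]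
    ring
  rw [← h1, h3, hW, coef_ofCoef (by omega)]

end Invariant

/-! ### The polynomials `P_{mk}` in terms of square roots. -/

section GeneratingFunction

variable {f : Type*} [Field f]

theorem aeval_P_mul (h2 : (2 : f) ≠ 0) {A : Type*} [CommRing A] [Algebra f A] (x : ℕ → A)
    (m k : ℕ) :
    MvPolynomial.aeval x (P f m k) * x 0 ^ m =
      sqrtCoeff (algebraMap f A 2⁻¹) (fun i => x i * x 0 ^ (i - 1)) (m + k) -
      sqrtCoeff (algebraMap f A 2⁻¹) (fun i => if i ≤ m then x i * x 0 ^ (i - 1) else 0)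
        (m + k) := by
  have h1 := congrArg (PowerSeries.coeff (m + k)) (generatingFunction f h2 m).1
  rw [mul_assoc, PowerSeries.coeff_C_mul, add_comm m k, PowerSeries.coeff_X_pow_mul,
    PowerSeries.coeff_mk] at h1
  have h3 := congrArg (MvPolynomial.aeval x) h1
  rw [map_mul, map_pow, MvPolynomial.aeval_X] at h3
  rw [mul_comm, h3, rootDiff, map_sub, map_sub, add_comm k m]
  have h4 (a : ℕ → MvPolynomial ℕ f) (b : ℕ → A) (n : ℕ)
      (H : ∀ i, 1 ≤ i → MvPolynomial.aeval x (a i) = b i) :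
      MvPolynomial.aeval x (sqrtCoeff (MvPolynomial.C 2⁻¹) a n) =
        sqrtCoeff (algebraMap f A 2⁻¹) b n := by
    have := map_sqrtCoeff (MvPolynomial.aeval x : MvPolynomial ℕ f →ₐ[f] A).toRingHom
      (MvPolynomial.C 2⁻¹) a n
    refine this.trans ?_
    have e : (MvPolynomial.aeval x : MvPolynomial ℕ f →ₐ[f] A).toRingHom (MvPolynomial.C 2⁻¹) =
      algebraMap f A 2⁻¹ := MvPolynomial.aeval_C x _
    rw [e]
    exact sqrtCoeff_congr _ _ fun i hi _ => H i hi
  congr 1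
  · rw [sqrtSeries, PowerSeries.coeff_mk]
    refine h4 _ _ _ fun i hi => ?_
    rw [fullSeries, PowerSeries.coeff_mk, if_neg (by omega)]
    simp
  · rw [sqrtSeries, PowerSeries.coeff_mk]
    refine h4 _ _ _ fun i hi => ?_
    rw [cutSeries, PowerSeries.coeff_mk, if_neg (by omega)]
    split_ifs <;> simp

/-- In the recursion for the root the newest coefficient enters only linearly, with factor `1 / 2`;
for `k ≥ 1` the cut series does not involve it. Division by `x_0 ^ m` leaves `x_0 ^ (k - 1) / 2`. -/
theorem aeval_P_eq_add (h2 : (2 : f) ≠ 0) {A : Type*} [CommRing A] [Algebra f A] (x : ℕ → A)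
    {m k : ℕ} (hk : 1 ≤ k) :
    MvPolynomial.aeval x (P f m k) = algebraMap f A 2⁻¹ * x 0 ^ (k - 1) * x (m + k) +
      MvPolynomial.aeval (Function.update x (m + k) 0) (P f m k) := by
  -- Proved for the universal variables, where `x_0 ^ m` can be cancelled, and then specialized; in
  -- `A` it could be a zero divisor.
  have key : P f m k = MvPolynomial.C 2⁻¹ * MvPolynomial.X 0 ^ (k - 1) * MvPolynomial.X (m + k) +
      MvPolynomial.aeval (Function.update MvPolynomial.X (m + k) 0) (P f m k) := by
    have h3 := aeval_P_mul h2 (MvPolynomial.X : ℕ → MvPolynomial ℕ f) m k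
    have h4 := aeval_P_mul h2
      (Function.update MvPolynomial.X (m + k) 0 : ℕ → MvPolynomial ℕ f) m k
    rw [MvPolynomial.aeval_X_left_apply] at h3
    obtain ⟨s, hs⟩ := Nat.exists_eq_add_of_le' (show 1 ≤ m + k by omega)
    have e0 : Function.update MvPolynomial.X (m + k) (0 : MvPolynomial ℕ f) 0 =
      MvPolynomial.X 0 := Function.update_of_ne (by omega) _ _
    have ei {i : ℕ} (hi : i < m + k) : Function.update MvPolynomial.X (m + k)
        (0 : MvPolynomial ℕ f) i = MvPolynomial.X i := Function.update_of_ne (by omega) _ _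
    have hcut : (fun i => if i ≤ m then Function.update MvPolynomial.X (m + k)
        (0 : MvPolynomial ℕ f) i * MvPolynomial.X 0 ^ (i - 1) else 0) =
        fun i => if i ≤ m then MvPolynomial.X i * MvPolynomial.X 0 ^ (i - 1) else 0 := by
      ext1 i
      split_ifs with him
      · rw [ei (by omega)]
      · rfl
    rw [e0, hcut] at h4
    refine mul_right_cancel₀ (pow_ne_zero m (MvPolynomial.X_ne_zero 0)) ?_
    rw [add_mul, h3, h4, hs, sqrtCoeff.eq_2 _ (fun i => MvPolynomial.X i * MvPolynomial.X 0 ^ (i - 1)),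
      sqrtCoeff.eq_2 _ (fun i => Function.update _ _ _ i * _), ← hs, Function.update_self, zero_mul,
      MvPolynomial.algebraMap_eq]
    have e : ∑ i : Fin s, sqrtCoeff (MvPolynomial.C (2⁻¹ : f)) (fun i =>
          Function.update MvPolynomial.X (m + k) 0 i * MvPolynomial.X 0 ^ (i - 1)) (i + 1) *
        sqrtCoeff (MvPolynomial.C 2⁻¹) (fun i =>
          Function.update MvPolynomial.X (m + k) 0 i * MvPolynomial.X 0 ^ (i - 1)) (s - i) =
        ∑ i : Fin s, sqrtCoeff (MvPolynomial.C (2⁻¹ : f)) (fun i =>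
          MvPolynomial.X i * MvPolynomial.X 0 ^ (i - 1)) (i + 1) *
        sqrtCoeff (MvPolynomial.C 2⁻¹) (fun i =>
          MvPolynomial.X i * MvPolynomial.X 0 ^ (i - 1)) (s - i) := by
      refine Finset.sum_congr rfl fun i _ => ?_
      rw [sqrtCoeff_congr _ _ fun j _ hj => by rw [ei (by omega)],
        sqrtCoeff_congr _ (s - i) fun j _ hj => by rw [ei (by omega)]]
    rw [e, show m + k - 1 = (k - 1) + m by omega, pow_add]
    ring
  have h5 := congrArg (MvPolynomial.aeval x) key
  rw [map_add, map_mul, map_mul, map_pow, MvPolynomial.aeval_X, MvPolynomial.aeval_X,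
    MvPolynomial.aeval_C] at h5
  rw [h5]
  congr 1
  rw [← AlgHom.comp_apply, MvPolynomial.comp_aeval]
  congr 2
  ext1 i
  by_cases hi : i = m + k
  · rw [hi, Function.update_self, Function.update_self, map_zero]
  · rw [Function.update_of_ne hi, Function.update_of_ne hi, MvPolynomial.aeval_X]

end GeneratingFunction

/-! ### Primality and dimension for the even equations. -/

section Elimination

variable {f : Type*} [Field f]

/-- An ideal modulo which all variables are expressed through those in the range of `ι`, without
relations between the latter, is prime, and its quotient is a polynomial ring. -/
theorem isPrime_and_ringKrullDim_of_retraction {σ τ : Type*} [Finite τ]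
    {I : Ideal (MvPolynomial σ f)} (φ : MvPolynomial σ f →ₐ[f] MvPolynomial τ f) (ι : τ → σ)
    (hι : ∀ j, φ (MvPolynomial.X (ι j)) = MvPolynomial.X j) (hI : I ≤ RingHom.ker φ)
    (hX : ∀ j, MvPolynomial.X j - MvPolynomial.rename ι (φ (MvPolynomial.X j)) ∈ I) :
    I.IsPrime ∧ ringKrullDim (MvPolynomial σ f ⧸ I) = (Nat.card τ : ℕ∞) := by
  have h1 : (Ideal.Quotient.mkₐ f I).comp ((MvPolynomial.rename ι).comp φ) =
      Ideal.Quotient.mkₐ f I :=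
    MvPolynomial.algHom_ext fun j => (Ideal.Quotient.eq.mpr (hX j)).symm
  have hker : RingHom.ker φ = I := by
    refine le_antisymm (fun q hq => ?_) hI
    have h2 := DFunLike.congr_fun h1 q
    rw [AlgHom.comp_apply, AlgHom.comp_apply, (RingHom.mem_ker).mp hq, map_zero, map_zero] at h2
    exact Ideal.Quotient.eq_zero_iff_mem.mp h2.symm
  have hsurj : Function.Surjective φ := by
    intro q
    refine ⟨MvPolynomial.rename ι q, ?_⟩
    have : φ.comp (MvPolynomial.rename ι) = AlgHom.id f _ :=
      MvPolynomial.algHom_ext fun j => by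
        rw [AlgHom.comp_apply, MvPolynomial.rename_X, hι, AlgHom.id_apply]
    exact DFunLike.congr_fun this q
  subst hker
  refine ⟨RingHom.ker_isPrime φ, ?_⟩
  rw [ringKrullDim_eq_of_ringEquiv
    (Ideal.quotientKerAlgEquivOfSurjective (f := φ) hsurj).toRingEquiv,
    MvPolynomial.ringKrullDim_of_isNoetherianRing, ringKrullDim_eq_zero_of_field, zero_add]
  rfl

/-- The equations express `l_n, …, l_{n-m}` as constants and, because `c 0 ≠ 0`, `l_{n/2}` as a
polynomial in the others. The quotient is a polynomial ring in the remaining variables. -/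
theorem isPrime_and_ringKrullDim_evenEquations (h2 : (2 : f) ≠ 0) {m n : ℕ} (hmn : 2 * m + 2 < n)
    (hn : Even n) {c : Fin (m + 2) → f} (hc : c 0 ≠ 0) :
    (Ideal.span (evenEquations f m n c)).IsPrime ∧
      ringKrullDim (Fun f m n ⧸ Ideal.span (evenEquations f m n c)) =
        ((n - 2 * m - 2 : ℕ) : ℕ∞) := by
  obtain ⟨N, rfl⟩ := hn
  obtain ⟨k, hk⟩ : ∃ k, N = m + k := ⟨N - m, by omega⟩
  have hk1 : 1 ≤ k := by omega
  have hkd : (N + N) / 2 - m = k := by omega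
  set I := Ideal.span (evenEquations f m (N + N) c) with hI
  -- The free variables: those not made constant, except the middle one.
  set s := (Finset.Icc (m + 1) (N + N - m - 1)).erase N with hs
  have mem_s {j : ℕ} : j ∈ s ↔ j ≠ N ∧ m + 1 ≤ j ∧ j ≤ N + N - m - 1 := by
    rw [hs, Finset.mem_erase, Finset.mem_Icc]
  set c' : ℕ → f := fun i => if h : i < m + 2 then c ⟨i, h⟩ else 0 with hc'
  have hc'i (i : Fin (m + 1)) : c' i = c i.castSucc := by
    rw [hc']; simp only [dif_pos (show (i : ℕ) < m + 2 by omega)]; rfl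
  have hc'0 : c' 0 = c 0 := hc'i 0
  -- The values of the variables with the middle one set to zero. Indices below `m + 1` also get
  -- zero, to match the default in `lfun`.
  set ψ : ℕ → MvPolynomial s f := fun j => if h : j ∈ s then MvPolynomial.X ⟨j, h⟩ else
    if N + N - m ≤ j then MvPolynomial.C (c' (N + N - j)) else 0 with hψ
  have hψN : ψ N = 0 := by
    rw [hψ]
    simp only [dif_neg (show N ∉ s by rw [mem_s]; simp), if_neg (show ¬ N + N - m ≤ N by omega)]
  set u : f := 2⁻¹ * c 0 ^ (k - 1) with hu
  have hu0 : u ≠ 0 := mul_ne_zero (inv_ne_zero h2) (pow_ne_zero _ hc)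
  -- The solution of the last equation for the middle variable; `u` is its coefficient there.
  set E : MvPolynomial s f := MvPolynomial.C u⁻¹ * (MvPolynomial.C (c (Fin.last (m + 1))) -
    MvPolynomial.aeval (fun i => ψ (N + N - i)) (P f m k)) with hE
  set φ : Fun f m (N + N) →ₐ[f] MvPolynomial s f :=
    MvPolynomial.aeval fun j => Function.update ψ N E j.1 with hφ
  have hφl (i : ℕ) : φ (lfun f m (N + N) (N + N - i)) = Function.update ψ N E (N + N - i) := by
    rw [lfun]
    split_ifs with h
    · rw [hφ, MvPolynomial.aeval_X]
    · rw [Finset.mem_Icc] at h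
      rw [map_zero, Function.update_of_ne (by omega), hψ]
      simp only [dif_neg (show N + N - i ∉ s by rw [mem_s]; omega),
        if_neg (show ¬ N + N - m ≤ N + N - i by omega)]
  have hψc {i : ℕ} (hi : i ≤ m) : ψ (N + N - i) = MvPolynomial.C (c' i) := by
    rw [hψ]
    simp only [dif_neg (show N + N - i ∉ s by rw [mem_s]; omega),
      if_pos (show N + N - m ≤ N + N - i by omega), show N + N - (N + N - i) = i by omega]
  have hψu : (fun i => ψ (N + N - i)) =
      Function.update (fun i => Function.update ψ N E (N + N - i)) (m + k) 0 := by
    ext1 i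
    by_cases hi : i = m + k
    · rw [hi, Function.update_self, ← hk, Nat.add_sub_cancel, hψN]
    · rw [Function.update_of_ne hi, Function.update_of_ne (by omega)]
  have hodd (i : Fin (m + 1)) :
      lfun f m (N + N) (N + N - i) - MvPolynomial.C (c' i) ∈ I :=
    Ideal.subset_span (Set.mem_insert_of_mem _ ⟨i, by rw [hc'i]⟩)
  have heven : MvPolynomial.aeval (fun i => lfun f m (N + N) (N + N - i)) (P f m k) -
      MvPolynomial.C (c (Fin.last (m + 1))) ∈ I := by
    refine Ideal.subset_span ?_
    rw [evenEquations, hkd]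
    exact Set.mem_insert _ _
  have hcard : Nat.card s = N + N - 2 * m - 2 := by
    rw [Nat.card_eq_fintype_card, Fintype.card_coe, hs, Finset.card_erase_of_mem, Nat.card_Icc]
    · omega
    · rw [Finset.mem_Icc]; omega
  have hmem (j : s) : j.1 ∈ Finset.Icc (m + 1) (N + N) := by
    have := mem_s.mp j.2
    rw [Finset.mem_Icc]; omega
  rw [← hcard]
  refine isPrime_and_ringKrullDim_of_retraction φ (fun j => ⟨j.1, hmem j⟩) ?_ ?_ ?_
  · intro j
    rw [hφ, MvPolynomial.aeval_X, Function.update_of_ne (mem_s.mp j.2).1, hψ]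
    simp only [dif_pos j.2]
  · rw [hI, Ideal.span_le]
    rintro q (rfl | ⟨i, rfl⟩)
    · rw [SetLike.mem_coe, RingHom.mem_ker, map_sub, hkd, ← AlgHom.comp_apply,
        MvPolynomial.comp_aeval]
      simp only [hφl]
      rw [aeval_P_eq_add h2 _ hk1, ← hψu]
      have e0 : Function.update ψ N E (N + N - 0) = MvPolynomial.C (c 0) := by
        rw [Function.update_of_ne (by omega), hψc (Nat.zero_le m), hc'0]
      have eN : Function.update ψ N E (N + N - (m + k)) = E := by
        rw [← hk, Nat.add_sub_cancel, Function.update_self]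
      have eC : φ (MvPolynomial.C (c (Fin.last (m + 1)))) =
        MvPolynomial.C (c (Fin.last (m + 1))) := φ.commutes _
      have e1 : (MvPolynomial.C u : MvPolynomial s f) * MvPolynomial.C u⁻¹ = 1 := by
        rw [← MvPolynomial.C_mul, mul_inv_cancel₀ hu0, MvPolynomial.C_1]
      rw [e0, eN, eC, MvPolynomial.algebraMap_eq, ← MvPolynomial.C_pow, ← MvPolynomial.C_mul, ← hu,
        hE]
      linear_combination (MvPolynomial.C (c (Fin.last (m + 1))) -
        MvPolynomial.aeval (fun i => ψ (N + N - i)) (P f m k)) * e1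
    · rw [SetLike.mem_coe, RingHom.mem_ker, map_sub, hφl, Function.update_of_ne (by omega),
        hψc (by omega), hc'i, sub_eq_zero]
      exact (φ.commutes _).symm
  · set ρ : MvPolynomial s f →ₐ[f] Fun f m (N + N) :=
      MvPolynomial.rename fun j : s => (⟨j.1, hmem j⟩ : Finset.Icc (m + 1) (N + N)) with hρ
    set π := Ideal.Quotient.mkₐ f I with hπ
    have hπ' {a b : Fun f m (N + N)} : π a = π b ↔ a - b ∈ I := Ideal.Quotient.eq
    have hψπ {i : ℕ} (hi : i ≠ N) : π (ρ (ψ (N + N - i))) = π (lfun f m (N + N) (N + N - i)) := by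
      by_cases him : i ≤ m
      · rw [hψc him, eq_comm, hπ']
        have e : ρ (MvPolynomial.C (c' i)) = MvPolynomial.C (c' i) := ρ.commutes _
        rw [e]
        exact hodd ⟨i, by omega⟩
      by_cases his : N + N - i ∈ s
      · congr 1
        rw [hψ, lfun]
        simp only [dif_pos his, dif_pos (hmem ⟨_, his⟩)]
        exact MvPolynomial.rename_X _ _
      · have h1 : N + N - i ∉ Finset.Icc (m + 1) (N + N) := by
          rw [mem_s] at his
          rw [Finset.mem_Icc]
          omega
        rw [hψ, lfun]
        simp only [dif_neg his, dif_neg h1, if_neg (show ¬ N + N - m ≤ N + N - i by omega),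
          map_zero]
    have hl (j : Finset.Icc (m + 1) (N + N)) : MvPolynomial.X j = lfun f m (N + N) j.1 := by
      rw [lfun, dif_pos j.2]
    intro j
    have hj := Finset.mem_Icc.mp j.2
    rw [← hπ', hφ, MvPolynomial.aeval_X]
    -- For the middle variable, the last equation is solved modulo `I`; every other variable matches
    -- `ψ` directly.
    by_cases hjN : j.1 = N
    · have h3 := hπ'.mpr heven
      rw [← AlgHom.comp_apply, MvPolynomial.comp_aeval, aeval_P_eq_add h2 _ hk1] at h3
      have e1 : Function.update (fun i => π (lfun f m (N + N) (N + N - i))) (m + k) 0 =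
          fun i => π (ρ (ψ (N + N - i))) := by
        ext1 i
        by_cases hi : i = m + k
        · rw [hi, Function.update_self, ← hk, Nat.add_sub_cancel, hψN, map_zero, map_zero]
        · rw [Function.update_of_ne hi, hψπ (by omega)]
      have e2 : π (lfun f m (N + N) (N + N - 0)) = algebraMap f _ (c 0) := by
        rw [← hψπ (by omega), hψc (Nat.zero_le m), hc'0]
        exact (π.comp ρ).commutes _
      have e3 : π (MvPolynomial.C (c (Fin.last (m + 1)))) =
        algebraMap f _ (c (Fin.last (m + 1))) := π.commutes _
      rw [e1, e2, e3, ← map_pow, ← map_mul, ← hu, ← hk, Nat.add_sub_cancel] at h3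
      have e4 : π (ρ E) = algebraMap f _ u⁻¹ * (algebraMap f _ (c (Fin.last (m + 1))) -
          MvPolynomial.aeval (fun i => π (ρ (ψ (N + N - i)))) (P f m k)) := by
        have e5 (x : f) : π (ρ (MvPolynomial.C x)) = algebraMap f _ x := (π.comp ρ).commutes x
        rw [hE, map_mul, map_mul, map_sub, map_sub, e5, e5, ← AlgHom.comp_apply π ρ,
          ← AlgHom.comp_apply _ (MvPolynomial.aeval _), MvPolynomial.comp_aeval]
        rfl
      rw [hjN, Function.update_self, e4, ← h3, add_sub_cancel_right, ← mul_assoc, ← map_mul,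
        inv_mul_cancel₀ hu0, map_one, one_mul, hl, hjN]
    · rw [Function.update_of_ne hjN, hl]
      have := hψπ (i := N + N - j.1) (by omega)
      rw [show N + N - (N + N - j.1) = j.1 by omega] at this
      exact this.symm

end Elimination

/-! ### Invariants and their separation of orbits. -/

section Orbits

variable {f : Type*} [Field f] {p m n : ℕ}

theorem exists_incl_eq_succ (hn : n + 2 ≤ p) {U : Trunc f p} (hU : t f p ^ (p - 2 - n) ∣ U) :
    ∃ ξ : Module.Dual f (Lq f p (m + 1) (n + 1)),
      incl f p (m + 1) (n + 1) ξ = form (m + 1) U := by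
  refine exists_incl_eq (m := m + 1) (n := n + 1) hn ?_
  rwa [show p - 1 - (n + 1) = p - 2 - n by omega]

variable [CharP f p]

theorem exists_form_eq_succ (hmn : m ≤ n) (hn : n + 2 ≤ p)
    (ξ : Module.Dual f (Lq f p (m + 1) (n + 1))) :
    ∃ U, t f p ^ (p - 2 - n) ∣ U ∧ incl f p (m + 1) (n + 1) ξ = form (m + 1) U := by
  have := exists_form_eq (Nat.succ_le_succ hmn) hn ξ
  rwa [show p - 1 - (n + 1) = p - 2 - n by omega] at this

theorem form_succ_eq_iff (hm : m + 2 ≤ p) {U V : Trunc f p} :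
    form (m + 1) U = form (m + 1) V ↔ t f p ^ (p - 2 - m) ∣ U - V := by
  rw [form_eq_iff hm, show p - 1 - (m + 1) = p - 2 - m by omega]

theorem value_aeval (ξ : Module.Dual f (Lq f p (m + 1) (n + 1))) (x : ℕ → Fun f m n)
    (q : MvPolynomial ℕ f) :
    value f p ξ (MvPolynomial.aeval x q) = MvPolynomial.aeval (fun i => value f p ξ (x i)) q := by
  have := DFunLike.congr_fun (MvPolynomial.comp_aeval x
    (MvPolynomial.aeval fun j : Finset.Icc (m + 1) n =>
      ξ (lq f p (n + 1) (Finset.mem_Icc.mp j.2).1))) q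
  simp only [value, ← MvPolynomial.coe_aeval_eq_eval] at this ⊢
  exact this

theorem value_sub_C_eq_zero_iff (ξ : Module.Dual f (Lq f p (m + 1) (n + 1))) (q : Fun f m n)
    (c : f) : value f p ξ (q - MvPolynomial.C c) = 0 ↔ value f p ξ q = c := by
  rw [value, value, map_sub, MvPolynomial.eval_C, sub_eq_zero]

theorem value_lfun_eq (ξ : Module.Dual f (Lq f p (m + 1) (n + 1))) {j : ℕ} (hj : m + 1 ≤ j)
    (hjn : j ≤ n) : value f p ξ (lfun f m n j) = ξ (lq f p (n + 1) hj) := by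
  rw [value, lfun, dif_pos (Finset.mem_Icc.mpr ⟨hj, hjn⟩), MvPolynomial.eval_X]

theorem value_lfun_of_lt (ξ : Module.Dual f (Lq f p (m + 1) (n + 1))) {j : ℕ} (hj : j < m + 1) :
    value f p ξ (lfun f m n j) = 0 := by
  rw [value, lfun, dif_neg (fun h => by have := Finset.mem_Icc.mp h; omega), map_zero]

theorem value_lfun {ξ : Module.Dual f (Lq f p (m + 1) (n + 1))} {U : Trunc f p}
    (h : incl f p (m + 1) (n + 1) ξ = form (m + 1) U) (hn : n + 2 ≤ p) {i : ℕ}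
    (hi : i + m + 1 ≤ n) : value f p ξ (lfun f m n (n - i)) = coef (p - 2 - n + i) U := by
  rw [value_lfun_eq ξ (by omega) (by omega), apply_lq h (by omega) (by omega),
    show p - 2 - (n - i) = p - 2 - n + i by omega]

theorem value_lfun_top {ξ : Module.Dual f (Lq f p (m + 1) (n + 1))} {U : Trunc f p}
    (h : incl f p (m + 1) (n + 1) ξ = form (m + 1) U) (hmn : m + 1 ≤ n) (hn : n + 2 ≤ p) :
    value f p ξ (lfun f m n n) = coef (p - 2 - n) U :=
  value_lfun (i := 0) h hn (by omega)

theorem exists_value_lfun_eq (hn : n + 2 ≤ p) (x : ℕ → f) :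
    ∃ ξ : Module.Dual f (Lq f p (m + 1) (n + 1)),
      ∀ i, i + m + 1 ≤ n → value f p ξ (lfun f m n (n - i)) = x i := by
  obtain ⟨ξ, hξ⟩ := exists_incl_eq_succ (m := m) (n := n) hn
    (U := ofCoef fun k => if p - 2 - n ≤ k then x (k - (p - 2 - n)) else 0)
    ((pow_dvd_iff (by omega)).mpr fun k hk => by
      rw [coef_ofCoef (by omega), if_neg (by omega)])
  refine ⟨ξ, fun i hi => ?_⟩
  rw [value_lfun hξ hn hi, coef_ofCoef (by omega), if_pos (by omega), Nat.add_sub_cancel_left]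

theorem dual_ext (hmn : m ≤ n) (hn : n + 2 ≤ p) {ξ η : Module.Dual f (Lq f p (m + 1) (n + 1))}
    (h : ∀ i, i + m + 1 ≤ n →
      value f p ξ (lfun f m n (n - i)) = value f p η (lfun f m n (n - i))) : ξ = η := by
  obtain ⟨U, hU, hξ⟩ := exists_form_eq_succ hmn hn ξ
  obtain ⟨V, hV, hη⟩ := exists_form_eq_succ hmn hn η
  refine incl_injective _ _ ?_
  rw [hξ, hη, form_succ_eq_iff (by omega)]
  refine (pow_dvd_iff (by omega)).mpr fun k hk => ?_
  by_cases hka : k < p - 2 - n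
  · exact (pow_dvd_iff (by omega)).mp (dvd_sub hU hV) k hka
  · obtain ⟨i, rfl⟩ := Nat.exists_eq_add_of_le (not_lt.mp hka)
    rw [map_sub, ← value_lfun hξ hn (by omega), ← value_lfun hη hn (by omega), h i (by omega),
      sub_self]

theorem Coadq_eq_self (hp : p.Prime) (hmn : m ≤ n) (hn : n + 2 ≤ p) (h : n ≤ 2 * m + 2)
    (g : Gq f p (m + 1) (n + 1)) (ξ : Module.Dual f (Lq f p (m + 1) (n + 1))) :
    Coadq f p (m + 1) (n + 1) g ξ = ξ := by
  obtain ⟨g, rfl⟩ := QuotientGroup.mk_surjective g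
  obtain ⟨U, hU, hξ⟩ := exists_form_eq_succ hmn hn ξ
  refine incl_injective _ _ ?_
  rw [incl_Coadq_eq_form hp (Nat.succ_pos m) g hξ, hξ, form_succ_eq_iff (by omega)]
  exact pow_dvd_act_sub_of_le hp.pos (by omega) hn h g.2 hU

/-- The functions `l_n, …, l_{n-m}` are invariant. -/
theorem value_lfun_Coadq (hp : p.Prime) (hmn : 2 * m + 2 < n) (hn : n + 2 ≤ p)
    (g : Gq f p (m + 1) (n + 1)) (ξ : Module.Dual f (Lq f p (m + 1) (n + 1))) {i : ℕ}
    (hi : i ≤ m) : value f p (Coadq f p (m + 1) (n + 1) g ξ) (lfun f m n (n - i)) =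
      value f p ξ (lfun f m n (n - i)) := by
  obtain ⟨g, rfl⟩ := QuotientGroup.mk_surjective g
  obtain ⟨U, hU, hξ⟩ := exists_form_eq_succ (by omega) hn ξ
  rw [value_lfun (incl_Coadq_eq_form hp (Nat.succ_pos m) g hξ) hn (by omega),
    value_lfun hξ hn (by omega)]
  exact coef_congr (n := p - 2 - n + (m + 1)) (by omega) (by omega)
    (pow_dvd_act_sub hp.pos (Nat.succ_pos m) (by omega) (by omega) g.2 hU)

/-- The value at `ξ` of the coefficient of `z ^ (n / 2)` in the square root of
`∑ (l_{n-i} / l_n) z ^ i`. -/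
def rootValue (ξ : Module.Dual f (Lq f p (m + 1) (n + 1))) : f :=
  sqrtCoeff 2⁻¹ (fun i => value f p ξ (lfun f m n (n - i)) / value f p ξ (lfun f m n n)) (n / 2)

theorem rootValue_eq {ξ : Module.Dual f (Lq f p (m + 1) (n + 1))} {U : Trunc f p}
    (h : incl f p (m + 1) (n + 1) ξ = form (m + 1) U) (hmn : 2 * m + 2 < n) (hn : n + 2 ≤ p) :
    rootValue ξ =
      sqrtCoeff 2⁻¹ (fun i => coef (p - 2 - n + i) U / coef (p - 2 - n) U) (n / 2) := by
  refine sqrtCoeff_congr _ _ fun i _ hi => ?_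
  rw [value_lfun h hn (by omega)]
  congr 1
  exact value_lfun_top h (by omega) hn

theorem two_ne_zero_of_lt (h : 2 < p) : (2 : f) ≠ 0 := by
  intro h2
  have : ((2 : ℕ) : f) = 0 := by exact_mod_cast h2
  rw [CharP.cast_eq_zero_iff f p] at this
  exact absurd (Nat.le_of_dvd two_pos this) (by omega)

theorem rootValue_Coadq (hp : p.Prime) (hmn : 2 * m + 2 < n) (hn : n + 2 ≤ p) (he : Even n)
    (g : Gq f p (m + 1) (n + 1)) {ξ : Module.Dual f (Lq f p (m + 1) (n + 1))}
    (h0 : value f p ξ (lfun f m n n) ≠ 0) :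
    rootValue (Coadq f p (m + 1) (n + 1) g ξ) = rootValue ξ := by
  obtain ⟨g, rfl⟩ := QuotientGroup.mk_surjective g
  obtain ⟨U, hU, hξ⟩ := exists_form_eq_succ (by omega) hn ξ
  have h1 : coef (p - 2 - n) U ≠ 0 := by
    rwa [← value_lfun_top hξ (by omega) hn]
  rw [rootValue_eq (incl_Coadq_eq_form hp (Nat.succ_pos m) g hξ) hmn hn, rootValue_eq hξ hmn hn]
  obtain ⟨N, hN⟩ := he.two_dvd
  have h2 : n / 2 = N := by omega
  rw [h2]
  subst hN
  exact sqrtCoeff_act hp (two_ne_zero_of_lt (p := p) (by omega)) hn hU h1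
    (G_le (Nat.succ_le_succ (Nat.zero_le m)) g.2)

/-- The recursion recovers the newest coefficient of the series from that of its root once the
earlier ones agree. -/
theorem sqrtCoeff_succ_injective {R : Type*} [CommRing R] {h : R} (hh : h * 2 = 1) {a b : ℕ → R}
    {n : ℕ} (H : ∀ i, 1 ≤ i → i ≤ n → a i = b i)
    (e : sqrtCoeff h a (n + 1) = sqrtCoeff h b (n + 1)) : a (n + 1) = b (n + 1) := by
  have h1 : ∑ i : Fin n, sqrtCoeff h a (i + 1) * sqrtCoeff h a (n - i) =
      ∑ i : Fin n, sqrtCoeff h b (i + 1) * sqrtCoeff h b (n - i) :=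
    Finset.sum_congr rfl fun i _ => by
      rw [sqrtCoeff_congr h _ fun j hj hj' => H j hj (by omega),
        sqrtCoeff_congr h (n - i) fun j hj hj' => H j hj (by omega)]
  rw [sqrtCoeff, sqrtCoeff, h1] at e
  linear_combination 2 * e - (a (n + 1) - b (n + 1)) * hh

/-- The invariants `l_n, …, l_{n-m}` and, for even `n`, the residue of the square root, separate
the orbits with `l_n ≠ 0`. -/
theorem mem_orbit_iff (hp : p.Prime) (hmn : 2 * m + 2 < n) (hn : n + 2 ≤ p)
    {ξ η : Module.Dual f (Lq f p (m + 1) (n + 1))} (h0 : value f p ξ (lfun f m n n) ≠ 0) :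
    (∃ g, Coadq f p (m + 1) (n + 1) g ξ = η) ↔
      (∀ i ≤ m, value f p ξ (lfun f m n (n - i)) = value f p η (lfun f m n (n - i))) ∧
        (Even n → rootValue ξ = rootValue η) := by
  constructor
  · rintro ⟨g, rfl⟩
    exact ⟨fun i hi => (value_lfun_Coadq hp hmn hn g ξ hi).symm,
      fun he => (rootValue_Coadq hp hmn hn he g h0).symm⟩
  rintro ⟨h1, h2⟩
  obtain ⟨U, hU, hξ⟩ := exists_form_eq_succ (by omega) hn ξ
  obtain ⟨V, hV, hη⟩ := exists_form_eq_succ (by omega) hn η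
  have hU0 : coef (p - 2 - n) U ≠ 0 := by
    rwa [← value_lfun_top hξ (by omega) hn]
  have hUV : t f p ^ (p - 2 - n + (m + 1)) ∣ U - V := by
    refine (pow_dvd_iff (by omega)).mpr fun k hk => ?_
    by_cases hka : k < p - 2 - n
    · exact (pow_dvd_iff (by omega)).mp (dvd_sub hU hV) k hka
    · obtain ⟨i, rfl⟩ := Nat.exists_eq_add_of_le (not_lt.mp hka)
      rw [map_sub, ← value_lfun hξ hn (by omega), ← value_lfun hη hn (by omega), h1 i (by omega),
        sub_self]
  -- At the exceptional step all earlier coefficients agree, so equality of the residues forces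
  -- equality of the middle coefficient.
  obtain ⟨g, hg, hgU⟩ := exists_act_pow_dvd hp hmn hn hU hU0 hUV fun j hj g hg hgU => by
    refine (pow_dvd_iff (by omega)).mpr fun k hk => ?_
    rcases (Nat.lt_succ_iff.mp hk).lt_or_eq with hkj | rfl
    · exact (pow_dvd_iff (by omega)).mp hgU k hkj
    have he : Even n := ⟨j, by omega⟩
    have hζ := incl_Coadq_eq_form hp (Nat.succ_pos m) ⟨g, hg⟩ hξ
    have h3 := (rootValue_Coadq hp hmn hn he (QuotientGroup.mk ⟨g, hg⟩) h0).trans (h2 he)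
    rw [rootValue_eq hζ hmn hn, rootValue_eq hη hmn hn] at h3
    obtain ⟨s, rfl⟩ : ∃ s, j = s + 1 := ⟨j - 1, by omega⟩
    rw [show n / 2 = s + 1 by omega] at h3
    have h4 {i : ℕ} (hi : i ≤ s) : coef (p - 2 - n + i) (act g U) = coef (p - 2 - n + i) V :=
      coef_congr (by omega) (by omega) hgU
    have h40 : coef (p - 2 - n) (act g U) = coef (p - 2 - n) V := h4 (Nat.zero_le s)
    have hV0 : coef (p - 2 - n) V ≠ 0 := by
      have := coef_congr (k := p - 2 - n) (by omega) (by omega) hUV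
      rwa [← this]
    have h5 := sqrtCoeff_succ_injective
      (inv_mul_cancel₀ (two_ne_zero_of_lt (f := f) (p := p) (by omega)))
      (fun i _ hi => by rw [h4 hi, h40]) h3
    change coef _ (act g U) / coef _ (act g U) = _ at h5
    rw [h40, div_left_inj' hV0] at h5
    rw [map_sub, h5, sub_self]
  refine ⟨QuotientGroup.mk ⟨g, hg⟩, incl_injective _ _ ?_⟩
  rw [incl_Coadq_eq_form hp (Nat.succ_pos m) ⟨g, hg⟩ hξ, hη, form_succ_eq_iff (by omega)]
  exact hgU

theorem inGeneralPosition_iff (hmn : 2 * m + 2 < n) (ξ : Module.Dual f (Lq f p (m + 1) (n + 1))) :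
    InGeneralPosition f p m n ξ ↔ value f p ξ (lfun f m n n) ≠ 0 := by
  rw [value_lfun_eq ξ (by omega) le_rfl]
  exact ⟨fun h => h hmn, fun h _ => h⟩

/-- For `n > 2m + 2` the function `l_n` is invariant, so general position need only be tested at one
point. -/
theorem isGeneralOrbit_range (hp : p.Prime) (hn : n + 2 ≤ p)
    {ξ : Module.Dual f (Lq f p (m + 1) (n + 1))} (hξ : InGeneralPosition f p m n ξ) :
    IsGeneralOrbit f p m n (Set.range fun g => Coadq f p (m + 1) (n + 1) g ξ) := by
  refine ⟨⟨ξ, rfl⟩, ?_⟩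
  rintro _ ⟨g, rfl⟩ hmn
  have h1 := (inGeneralPosition_iff hmn ξ).mp hξ
  have h2 := value_lfun_Coadq hp hmn hn g ξ (Nat.zero_le m)
  rw [Nat.sub_zero] at h2
  rw [← h2] at h1
  exact (inGeneralPosition_iff hmn _).mpr h1 hmn

theorem mem_orbit_self {Γ V : Type*} [Group Γ] [AddCommGroup V] [Module f V]
    (ρ : Representation f Γ V) (v : V) : v ∈ Set.range fun g : Γ => ρ g v :=
  ⟨1, by simp⟩

/-- Invariants that separate the orbits in a general position parametrize them. -/
theorem bijOn_generalOrbits (hp : p.Prime) (hmn : 2 * m + 2 < n) (hn : n + 2 ≤ p) {r : ℕ}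
    (κ : Module.Dual f (Lq f p (m + 1) (n + 1)) → Fin (r + 1) → f)
    (loc : (Fin (r + 1) → f) → Set (Module.Dual f (Lq f p (m + 1) (n + 1))))
    (hloc : ∀ c ξ, ξ ∈ loc c ↔ κ ξ = c) (hκ0 : ∀ ξ, κ ξ 0 = value f p ξ (lfun f m n n))
    (horb : ∀ ξ η, κ ξ 0 ≠ 0 → ((∃ g, Coadq f p (m + 1) (n + 1) g ξ = η) ↔ κ ξ = κ η))
    (hsurj : ∀ c, c 0 ≠ 0 → ∃ ξ, κ ξ = c) :
    Set.BijOn loc {c | c 0 ≠ 0} {O | IsGeneralOrbit f p m n O} := by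
  have key {c : Fin (r + 1) → f} (hc : c 0 ≠ 0) {ξ} (hξ : κ ξ = c) :
      loc c = Set.range fun g => Coadq f p (m + 1) (n + 1) g ξ := by
    ext η
    rw [hloc, Set.mem_range, horb ξ η (by rwa [hξ]), hξ, eq_comm]
  refine ⟨fun c hc => ?_, fun c hc d hd hcd => ?_, ?_⟩
  · obtain ⟨ξ, hξ⟩ := hsurj c hc
    change IsGeneralOrbit f p m n (loc c)
    rw [key hc hξ]
    refine isGeneralOrbit_range hp hn ((inGeneralPosition_iff hmn ξ).mpr ?_)
    rw [← hκ0, hξ]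
    exact hc
  · obtain ⟨ξ, hξ⟩ := hsurj c hc
    have h1 : ξ ∈ loc d := hcd ▸ (hloc c ξ).mpr hξ
    rw [← hξ, (hloc d ξ).mp h1]
  · rintro O ⟨⟨ξ, rfl⟩, hO⟩
    have h1 := (inGeneralPosition_iff hmn ξ).mp (hO ξ (mem_orbit_self _ ξ))
    rw [← hκ0] at h1
    exact ⟨κ ξ, h1, key h1 rfl⟩

end Orbits

/-! ### Parameters of the orbits and their leading terms. -/

section Parametrization

variable {f : Type*} [Field f] {p m n : ℕ}

/-- Every nonzero quadratic differential has a leading coefficient, up to the range in which the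
action is trivial. -/
theorem exists_leading {U : Trunc f p} {i : ℕ} (hmi : m ≤ i) (hi : i + 2 ≤ p)
    (hU : t f p ^ (p - 2 - i) ∣ U) :
    ∃ n, m ≤ n ∧ n ≤ i ∧ min (2 * m + 2) i ≤ n ∧ t f p ^ (p - 2 - n) ∣ U ∧
      (2 * m + 2 < n → coef (p - 2 - n) U ≠ 0) := by
  induction i, hmi using Nat.le_induction with
  | base => exact ⟨m, le_rfl, le_rfl, min_le_right _ _, hU, fun h => by omega⟩
  | succ i hmi ih =>
    by_cases h1 : i + 1 ≤ 2 * m + 2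
    · exact ⟨i + 1, by omega, le_rfl, min_le_right _ _, hU, fun h => by omega⟩
    by_cases h2 : coef (p - 2 - (i + 1)) U = 0
    · obtain ⟨n, h3, h4, h5, h6⟩ := ih (by omega) ((pow_dvd_iff (by omega)).mpr fun k hk => by
        rcases (show k < p - 2 - (i + 1) ∨ k = p - 2 - (i + 1) by omega) with h | rfl
        · exact (pow_dvd_iff (by omega)).mp hU k h
        · exact h2)
      exact ⟨n, h3, by omega, by omega, h6⟩
    · exact ⟨i + 1, by omega, le_rfl, min_le_right _ _, hU, fun _ => h2⟩

variable [CharP f p]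

theorem mem_locus_oddEquations (c : Fin (m + 1) → f)
    (ξ : Module.Dual f (Lq f p (m + 1) (n + 1))) :
    ξ ∈ locus f p (oddEquations f m n c) ↔
      (fun i : Fin (m + 1) => value f p ξ (lfun f m n (n - i))) = c := by
  rw [funext_iff]
  constructor
  · exact fun h i => (value_sub_C_eq_zero_iff _ _ _).mp (h _ ⟨i, rfl⟩)
  · rintro h _ ⟨i, rfl⟩
    exact (value_sub_C_eq_zero_iff _ _ _).mpr (h i)

theorem mem_locus_evenEquations (c : Fin (m + 2) → f)
    (ξ : Module.Dual f (Lq f p (m + 1) (n + 1))) :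
    ξ ∈ locus f p (evenEquations f m n c) ↔
      (Fin.snoc (fun i : Fin (m + 1) => value f p ξ (lfun f m n (n - i)))
        (MvPolynomial.aeval (fun i => value f p ξ (lfun f m n (n - i))) (P f m (n / 2 - m))) :
          Fin (m + 2) → f) = c := by
  rw [funext_iff, Fin.forall_fin_succ']
  simp only [Fin.snoc_castSucc, Fin.snoc_last]
  rw [← funext_iff, ← mem_locus_oddEquations, ← value_aeval, ← value_sub_C_eq_zero_iff]
  constructor
  · exact fun h => ⟨fun q hq => h q (Set.mem_insert_of_mem _ hq), h _ (Set.mem_insert _ _)⟩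
  · rintro ⟨h1, h2⟩ q (rfl | hq)
    · exact h2
    · exact h1 q hq

theorem bijOn_oddEquations (hp : p.Prime) (hmn : 2 * m + 2 < n) (hn : n + 2 ≤ p) (ho : Odd n) :
    Set.BijOn (fun c => locus f p (oddEquations f m n c)) {c : Fin (m + 1) → f | c 0 ≠ 0}
      {O | IsGeneralOrbit f p m n O} := by
  refine bijOn_generalOrbits hp hmn hn
    (fun ξ (i : Fin (m + 1)) => value f p ξ (lfun f m n (n - i))) _ mem_locus_oddEquations
    (fun ξ => rfl) (fun ξ η h0 => ?_) fun c _ => ?_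
  · rw [mem_orbit_iff hp hmn hn h0, funext_iff, Fin.forall_iff]
    simp only [Nat.not_even_iff_odd.mpr ho, false_imp_iff, and_true, Nat.lt_succ_iff]
  · obtain ⟨ξ, hξ⟩ := exists_value_lfun_eq (m := m) hn
      (fun i => if h : i < m + 1 then c ⟨i, h⟩ else 0)
    refine ⟨ξ, funext fun i => ?_⟩
    rw [hξ _ (by omega), dif_pos i.2]

/-- After multiplication by `x_0 ^ m`, the polynomial is `x_0 ^ (m + k)` times the normalized root
coefficient, minus a term depending only on `x_0, …, x_m`. -/
theorem aeval_P_eq_iff (h2 : (2 : f) ≠ 0) {x y : ℕ → f} (h0 : x 0 ≠ 0) (k : ℕ)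
    (hxy : ∀ i ≤ m, x i = y i) :
    MvPolynomial.aeval x (P f m k) = MvPolynomial.aeval y (P f m k) ↔
      sqrtCoeff 2⁻¹ (fun i => x i / x 0) (m + k) = sqrtCoeff 2⁻¹ (fun i => y i / y 0) (m + k) := by
  have hs (z : ℕ → f) (hz : z 0 ≠ 0) : sqrtCoeff 2⁻¹ (fun i => z i * z 0 ^ (i - 1)) (m + k) =
      z 0 ^ (m + k) * sqrtCoeff 2⁻¹ (fun i => z i / z 0) (m + k) := by
    rw [← sqrtCoeff_scale]
    refine sqrtCoeff_congr _ _ fun i hi _ => ?_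
    obtain ⟨j, rfl⟩ := Nat.exists_eq_add_of_le' hi
    rw [Nat.add_sub_cancel, pow_succ]
    field_simp
  have e0 := hxy 0 (Nat.zero_le m)
  have hcut : (fun i => if i ≤ m then x i * x 0 ^ (i - 1) else 0) =
      fun i => if i ≤ m then y i * y 0 ^ (i - 1) else 0 := by
    ext1 i
    split_ifs with hi
    · rw [hxy i hi, e0]
    · rfl
  have hx := aeval_P_mul h2 x m k
  have hy := aeval_P_mul h2 y m k
  rw [Algebra.algebraMap_self_apply, hs x h0, hcut] at hx
  rw [Algebra.algebraMap_self_apply, hs y (e0 ▸ h0), ← e0] at hy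
  rw [← mul_left_inj' (pow_ne_zero m h0), hx, hy, ← e0, sub_left_inj,
    mul_right_inj' (pow_ne_zero _ h0)]

theorem bijOn_evenEquations (hp : p.Prime) (hmn : 2 * m + 2 < n) (hn : n + 2 ≤ p)
    (he : Even n) :
    Set.BijOn (fun c => locus f p (evenEquations f m n c)) {c : Fin (m + 2) → f | c 0 ≠ 0}
      {O | IsGeneralOrbit f p m n O} := by
  have h2 : (2 : f) ≠ 0 := two_ne_zero_of_lt (p := p) (by omega)
  have hmk : m + (n / 2 - m) = n / 2 := by omega
  refine bijOn_generalOrbits hp hmn hn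
    (fun ξ => (Fin.snoc (fun i : Fin (m + 1) => value f p ξ (lfun f m n (n - i)))
        (MvPolynomial.aeval (fun i => value f p ξ (lfun f m n (n - i))) (P f m (n / 2 - m))) :
          Fin (m + 2) → f)) _ mem_locus_evenEquations
    (fun ξ => ?_) (fun ξ η h0 => ?_) fun c hc => ?_
  · exact Fin.snoc_castSucc (α := fun _ => f) _ _ (0 : Fin (m + 1))
  · have h0' : value f p ξ (lfun f m n n) ≠ 0 := by
      have := Fin.snoc_castSucc (α := fun _ => f)
        (MvPolynomial.aeval (fun i => value f p ξ (lfun f m n (n - i))) (P f m (n / 2 - m)))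
        (fun i : Fin (m + 1) => value f p ξ (lfun f m n (n - i))) (0 : Fin (m + 1))
      rwa [Fin.castSucc_zero] at this
    rw [mem_orbit_iff hp hmn hn h0', funext_iff, Fin.forall_fin_succ']
    simp only [Fin.snoc_castSucc, Fin.snoc_last, he, true_imp_iff, Fin.forall_iff, Nat.lt_succ_iff]
    refine and_congr_right fun h => ?_
    rw [aeval_P_eq_iff h2 h0' _ h, hmk]
    rfl
  · set k := n / 2 - m with hk
    have hk1 : 1 ≤ k := by omega
    set x : ℕ → f := fun i => if h : i < m + 1 then c (Fin.castSucc ⟨i, h⟩) else 0 with hx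
    have hx0 : x 0 = c 0 := rfl
    have hxk : Function.update x (m + k) 0 = x := by
      refine Function.update_eq_self_iff.mpr ?_
      rw [hx]
      simp only [dif_neg (show ¬ m + k < m + 1 by omega)]
    set u : f := 2⁻¹ * c 0 ^ (k - 1) with hu
    have hu0 : u ≠ 0 := mul_ne_zero (inv_ne_zero h2) (pow_ne_zero _ hc)
    -- To realize prescribed parameters, the free coordinates are put to zero and the last equation
    -- is solved for `l_{n/2}`.
    set z := (c (Fin.last (m + 1)) - MvPolynomial.aeval x (P f m k)) / u with hz
    obtain ⟨ξ, hξ⟩ := exists_value_lfun_eq (p := p) (m := m) hn (Function.update x (m + k) z)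
    have hξ' : (fun i => value f p ξ (lfun f m n (n - i))) = Function.update x (m + k) z := by
      ext1 i
      by_cases hi : i + m + 1 ≤ n
      · exact hξ i hi
      · rw [value_lfun_of_lt ξ (by omega), Function.update_of_ne (by omega), hx]
        simp only [dif_neg (show ¬ i < m + 1 by omega)]
    refine ⟨ξ, ?_⟩
    rw [funext_iff, Fin.forall_fin_succ']
    simp only [Fin.snoc_castSucc, Fin.snoc_last]
    constructor
    · intro i
      rw [hξ i (by omega), Function.update_of_ne (by omega), hx]
      simp only [dif_pos i.2]
    · rw [hξ', aeval_P_eq_add h2 _ hk1, Function.update_idem, hxk, Function.update_self,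
        Function.update_of_ne (by omega), hx0, Algebra.algebraMap_self_apply, ← hu, hz,
        mul_div_cancel₀ _ hu0, sub_add_cancel]

theorem exists_affineSubspace (hmn : 2 * m + 2 < n) (hn : n + 2 ≤ p) (c : Fin (m + 1) → f) :
    ∃ S : AffineSubspace f (Module.Dual f (Lq f p (m + 1) (n + 1))),
      (S : Set _) = locus f p (oddEquations f m n c) ∧
      Module.finrank f S.direction = n - 2 * m - 1 := by
  have hj (j : Fin (n - m)) : m + 1 ≤ n - (j : ℕ) := by omega
  let Φ : Module.Dual f (Lq f p (m + 1) (n + 1)) →ₗ[f] (Fin (n - m) → f) :=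
    -- All `n - m` coordinates `l_n, …, l_{m+1}`; the equations fix the first `m + 1`, leaving
    -- dimension `n - 2m - 1`.
    LinearMap.pi fun j => Module.Dual.eval f _ (lq f p (n + 1) (hj j))
  have hΦ (ξ) (j : Fin (n - m)) : Φ ξ j = value f p ξ (lfun f m n (n - j)) :=
    (value_lfun_eq ξ (hj j) (by omega)).symm
  have hΦb : Function.Bijective Φ := by
    constructor
    · intro ξ η h
      refine dual_ext (by omega) hn fun i hi => ?_
      have := congrFun h ⟨i, by omega⟩
      rwa [hΦ, hΦ] at this
    · intro x
      obtain ⟨ξ, hξ⟩ := exists_value_lfun_eq (p := p) (m := m) hn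
        (fun i => if h : i < n - m then x ⟨i, h⟩ else 0)
      refine ⟨ξ, funext fun j => ?_⟩
      rw [hΦ, hξ _ (by omega), dif_pos j.2]
  let e := LinearEquiv.ofBijective Φ hΦb
  have hfin : FiniteDimensional f (Module.Dual f (Lq f p (m + 1) (n + 1))) :=
    Module.Finite.equiv e.symm
  let T : (Fin (n - m) → f) →ₗ[f] (Fin (m + 1) → f) :=
    LinearMap.funLeft f f (Fin.castLE (by omega))
  have hT : Function.Surjective T :=
    LinearMap.funLeft_surjective_of_injective f f _ (Fin.castLE_injective _)
  have hTΦ (ξ) (i : Fin (m + 1)) : (T ∘ₗ Φ) ξ i = value f p ξ (lfun f m n (n - i)) := hΦ ξ _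
  have hs : Function.Surjective (T ∘ₗ Φ) := hT.comp hΦb.2
  obtain ⟨ξ₀, hξ₀⟩ := hs c
  refine ⟨AffineSubspace.mk' ξ₀ (LinearMap.ker (T ∘ₗ Φ)), ?_, ?_⟩
  · ext ξ
    rw [SetLike.mem_coe, AffineSubspace.mem_mk', vsub_eq_sub, LinearMap.mem_ker, map_sub, hξ₀,
      sub_eq_zero, mem_locus_oddEquations, ← funext (hTΦ ξ)]
  · rw [AffineSubspace.direction_mk']
    have h1 := LinearMap.finrank_range_add_finrank_ker (T ∘ₗ Φ)
    rw [LinearMap.range_eq_top.mpr hs, finrank_top, e.finrank_eq, Module.finrank_fin_fun,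
      Module.finrank_fin_fun] at h1
    omega

/-- Choosing `n` by the order of `U` makes `l_n` its leading coefficient; the descent stops at `2m +
2`, where no condition remains. -/
theorem exists_inGeneralPosition {U : Trunc f p} {i : ℕ} (hmi : m ≤ i) (hi : i + 2 ≤ p)
    (hU : t f p ^ (p - 2 - i) ∣ U) :
    ∃ n, n ≤ i ∧ min (2 * m + 2) i ≤ n ∧ ∃ ξ : Module.Dual f (Lq f p (m + 1) (n + 1)),
      incl f p (m + 1) (n + 1) ξ = form (m + 1) U ∧ InGeneralPosition f p m n ξ := by
  obtain ⟨n, h1, h2, h3, h4, h5⟩ := exists_leading hmi hi hU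
  obtain ⟨ξ, hξ⟩ := exists_incl_eq_succ (m := m) (n := n) (by omega) h4
  refine ⟨n, h2, h3, ξ, hξ, fun h => ?_⟩
  rw [apply_lq hξ (by omega) (by omega)]
  exact h5 h

end Parametrization

end TruncatedLine

end

/-! ### Assembly of the classification. -/

theorem theorem8 (f : Type*) [Field f] (p : ℕ) [Fact p.Prime] [CharP f p]
    (m : ℕ) (hm : m + 2 ≤ p) :
    (∀ n : ℕ, m ≤ n → n + 2 ≤ p →
      -- small `n`: every orbit is a point, every point is an orbit, all in a general position
      (n ≤ 2 * m + 2 →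
        (∀ O, TruncatedLine.IsOrbit (TruncatedLine.Coadq f p (m + 1) (n + 1)) O ↔
          ∃ ξ, O = {ξ}) ∧
        (∀ O, TruncatedLine.IsOrbit (TruncatedLine.Coadq f p (m + 1) (n + 1)) O →
          TruncatedLine.IsGeneralOrbit f p m n O)) ∧
      -- large odd `n`
      (2 * m + 2 < n → Odd n →
        Set.BijOn (fun c => TruncatedLine.locus f p (TruncatedLine.oddEquations f m n c))
          {c : Fin (m + 1) → f | c 0 ≠ 0} {O | TruncatedLine.IsGeneralOrbit f p m n O} ∧
        ∀ c : Fin (m + 1) → f, c 0 ≠ 0 →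
          ∃ S : AffineSubspace f
              (Module.Dual f (TruncatedLine.Lq f p (m + 1) (n + 1))),
            (S : Set _) = TruncatedLine.locus f p (TruncatedLine.oddEquations f m n c) ∧
            Module.finrank f S.direction = n - 2 * m - 1) ∧
      -- large even `n`
      (2 * m + 2 < n → Even n →
        Set.BijOn (fun c => TruncatedLine.locus f p (TruncatedLine.evenEquations f m n c))
          {c : Fin (m + 2) → f | c 0 ≠ 0} {O | TruncatedLine.IsGeneralOrbit f p m n O} ∧
        ∀ c : Fin (m + 2) → f, c 0 ≠ 0 →
          (Ideal.span (TruncatedLine.evenEquations f m n c)).IsPrime ∧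
          ringKrullDim (TruncatedLine.Fun f m n ⧸
            Ideal.span (TruncatedLine.evenEquations f m n c)) = ((n - 2 * m - 2 : ℕ) : ℕ∞)) ∧
      -- orbits in a general position remain orbits
      (∀ O, TruncatedLine.IsGeneralOrbit f p m n O →
        (∀ (i : ℕ) (h : n ≤ i), i + 2 ≤ p →
          TruncatedLine.IsOrbit (TruncatedLine.Coadq f p (m + 1) (i + 1))
            (TruncatedLine.inclq f p (m + 1) (Nat.add_le_add_right h 1) '' O)) ∧
        TruncatedLine.IsOrbit (TruncatedLine.Coad f p (m + 1))
          (TruncatedLine.incl f p (m + 1) (n + 1) '' O))) ∧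
    -- every orbit is an orbit in a general position for some `n`
    (∀ i : ℕ, m ≤ i → i + 2 ≤ p →
      ∀ O, TruncatedLine.IsOrbit (TruncatedLine.Coadq f p (m + 1) (i + 1)) O →
        ∃ (n : ℕ) (h : n ≤ i), min (2 * m + 2) i ≤ n ∧
          ∃ O', TruncatedLine.IsGeneralOrbit f p m n O' ∧
            O = TruncatedLine.inclq f p (m + 1) (Nat.add_le_add_right h 1) '' O') ∧
    (∀ O, TruncatedLine.IsOrbit (TruncatedLine.Coad f p (m + 1)) O →
      ∃ n : ℕ, min (2 * m + 2) (p - 2) ≤ n ∧ n ≤ p - 2 ∧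
        ∃ O', TruncatedLine.IsGeneralOrbit f p m n O' ∧
          O = TruncatedLine.incl f p (m + 1) (n + 1) '' O') := by
  have hp : p.Prime := Fact.out
  refine ⟨fun n hmn hn => ⟨fun h => ?_, fun h ho => ?_, fun h he => ?_, fun O hO => ?_⟩,
    fun i hmi hi O hO => ?_, fun O hO => ?_⟩
  · have horb (ξ : Module.Dual f (TruncatedLine.Lq f p (m + 1) (n + 1))) :
        Set.range (fun g => TruncatedLine.Coadq f p (m + 1) (n + 1) g ξ) = {ξ} := by
      simp only [TruncatedLine.Coadq_eq_self hp hmn hn h, Set.range_const]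
    exact ⟨fun O => ⟨fun ⟨ξ, hξ⟩ => ⟨ξ, hξ.trans (horb ξ)⟩,
        fun ⟨ξ, hξ⟩ => ⟨ξ, hξ.trans (horb ξ).symm⟩⟩,
      fun O hO => ⟨hO, fun _ _ h' => absurd h' (by omega)⟩⟩
  · exact ⟨TruncatedLine.bijOn_oddEquations hp h hn ho,
      fun c _ => TruncatedLine.exists_affineSubspace h hn c⟩
  · exact ⟨TruncatedLine.bijOn_evenEquations hp h hn he, fun c hc =>
      TruncatedLine.isPrime_and_ringKrullDim_evenEquations
        (TruncatedLine.two_ne_zero_of_lt (p := p) (by omega)) h he hc⟩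
  · obtain ⟨⟨ξ, rfl⟩, -⟩ := hO
    exact ⟨fun i h _ => ⟨_, TruncatedLine.inclq_image_orbit (Nat.add_le_add_right h 1) ξ⟩,
      ⟨_, TruncatedLine.incl_image_orbit ξ⟩⟩
  · obtain ⟨η, rfl⟩ := hO
    obtain ⟨U, hU, hη⟩ := TruncatedLine.exists_form_eq_succ hmi hi η
    obtain ⟨n, h1, h2, ξ, hξ, hg⟩ := TruncatedLine.exists_inGeneralPosition hmi hi hU
    refine ⟨n, h1, h2, _, TruncatedLine.isGeneralOrbit_range hp (by omega) hg, ?_⟩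
    rw [TruncatedLine.inclq_image_orbit]
    have : TruncatedLine.inclq f p (m + 1) (Nat.add_le_add_right h1 1) ξ = η :=
      TruncatedLine.incl_injective _ _ (by rw [TruncatedLine.incl_inclq, hξ, hη])
    rw [this]
  · obtain ⟨η, rfl⟩ := hO
    obtain ⟨U, rfl⟩ := TruncatedLine.form_surjective (f := f) (m := m + 1) hm η
    -- With `i = p - 2` the order condition on `U` is void, so the full dual is covered by the same
    -- argument.
    obtain ⟨n, h1, h2, ξ, hξ, hg⟩ := TruncatedLine.exists_inGeneralPosition (f := f) (p := p)
      (m := m) (i := p - 2) (U := U) (by omega) (by omega)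
      (by rw [Nat.sub_self, pow_zero]; exact one_dvd _)
    refine ⟨n, h2, h1, _, TruncatedLine.isGeneralOrbit_range hp (by omega) hg, ?_⟩
    rw [TruncatedLine.incl_image_orbit, hξ]
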